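/- Let $N\ge 2$ be an integer and let $a:[0,\infty)\to[0,\infty)$ be a function that is $C^1$ on $(0,\infty)$. Put $A(t)=\int_0^{|t|}a(s)s\,ds$ for $t\in\mathbb R$, and assume: $(a_1)$ $(a(t)t)'>0$ for all $t>0$; $(a_2)$ there are $l,m\in(1,N)$ with $l\le m<l^*:=\frac{lN}{N-l}$ such that $l\le \frac{a(|t|)t^2}{A(t)}\le m$ for all $t\ne 0$. An N-function is a continuous, convex, even function $\Phi:\mathbb R\to[0,\infty)$ with $\Phi(t)=0\Leftrightarrow t=0$, $\Phi(t)/t\to0$ as $t\to0$ and $\Phi(t)/t\to+\infty$ as $t\to+\infty$; it satisfies the $\Delta_2$-condition if for some $K>0$ one has $\Phi(2t)\le K\Phi(t)$ for all $t\ge0$. (Under $(a_1)$–$(a_2)$, $A$ is such a function.) For an N-function $\Phi$ satisfying the $\Delta_2$-condition, $L_\Phi(\mathbb R^N)$ is the space of measurable $u$ with $\int_{\mathbb R^N}\Phi(|u|)<\infty$, with the Luxemburg norm $\|u\|_\Phi=\inf\{\alpha>0:\int_{\mathbb R^N}\Phi(|u|/\alpha)\le1\}$, and $W^1L_\Phi(\mathbb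 R^N)$ is the completion of $C_c^\infty(\mathbb R^N)$ for the norm $\|u\|=\|\nabla u\|_\Phi+\|u\|_\Phi$. Let $A^{-1}$ be the inverse of $A|_{[0,\infty)}$, and let $A_*$ be the Sobolev conjugate of $A$, that is, the even function whose restriction to $[0,\infty)$ is the inverse of $t\mapsto\int_0^t A^{-1}(s)\,s^{-(N+1)/N}\,ds$. Let $(u_n)$ be a bounded sequence in $W^1L_A(\mathbb R^N)$ such that, for some $R>0$, $$\lim_{n\to\infty}\ \sup_{y\in\mathbb R^N}\int_{B_R(y)}A(|u_n|)\,dx=0 .$$ Then, for every N-function $B$ satisfying the $\Delta_2$-condition with $$\lim_{t\to0}\frac{B(t)}{A(t)}=0\qquad\text{and}\qquad \lim_{|t|\to+\infty}\frac{B(t)}{A_*(t)}=0,$$ every $u_n$ belongs to $L_B(\mathbb R^N)$ and $u_n\to0$ in $L_B(\mathbb R^N)$, i.e. $\|u_n\|_B\to0$. -/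

import Mathlib

open MeasureTheory Filter Topology Set
open scoped ENNReal NNReal ContDiff

noncomputable section

namespace OrliczLions

/-- An N-function: a continuous, convex, even function `Φ : ℝ → [0, ∞)` vanishing only at `0`, with
`Φ(t)/t → 0` as `t → 0` and `Φ(t)/t → +∞` as `t → +∞`. -/
structure IsNFunction (Φ : ℝ → ℝ) : Prop where
  continuous : Continuous Φ
  nonneg : ∀ t, 0 ≤ Φ t
  convex : ConvexOn ℝ univ Φ
  eq_zero_iff : ∀ t, Φ t = 0 ↔ t = 0
  tendsto_zero : Tendsto (fun t => Φ t / t) (𝓝[≠] 0) (𝓝 0)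
  tendsto_atTop : Tendsto (fun t => Φ t / t) atTop atTop
  even : ∀ t, Φ (-t) = Φ t

/-- The (global) `Δ₂`-condition. -/
def SatisfiesDelta2 (Φ : ℝ → ℝ) : Prop :=
  ∃ K : ℝ, 0 < K ∧ ∀ t : ℝ, 0 ≤ t → Φ (2 * t) ≤ K * Φ t

/-- `A(t) = ∫₀^{|t|} a(s) s ds`. -/
def primitiveA (a : ℝ → ℝ) (t : ℝ) : ℝ := ∫ s in (0 : ℝ)..|t|, a s * s

/-- The inverse of the restriction of `Φ` to `[0, ∞)`. -/
def invOnNonneg (Φ : ℝ → ℝ) : ℝ → ℝ := Function.invFunOn Φ (Ici 0)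

/-- The function `t ↦ ∫₀^t Φ⁻¹(s) / s^{(N+1)/N} ds`, which is the inverse of the Sobolev conjugate
of `Φ` on `[0, ∞)`. -/
def sobolevConjugateInv (N : ℕ) (Φ : ℝ → ℝ) (t : ℝ) : ℝ :=
  ∫ s in (0 : ℝ)..t, invOnNonneg Φ s / s ^ (((N : ℝ) + 1) / (N : ℝ))

/-- The Sobolev conjugate `Φ_*` of `Φ` in dimension `N`: on `[0, ∞)` it is the inverse of
`sobolevConjugateInv N Φ`, and it is extended to `ℝ` as an even function. -/
def sobolevConjugate (N : ℕ) (Φ : ℝ → ℝ) (t : ℝ) : ℝ :=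
  invOnNonneg (sobolevConjugateInv N Φ) |t|

/-- The modular `∫_S Φ(|u|) ∈ [0, ∞]` over a set `S ⊆ ℝ^N`. -/
def modularOn {N : ℕ} {F : Type*} [NormedAddCommGroup F] (Φ : ℝ → ℝ)
    (S : Set (EuclideanSpace ℝ (Fin N))) (u : EuclideanSpace ℝ (Fin N) → F) : ℝ≥0∞ :=
  ∫⁻ x in S, ENNReal.ofReal (Φ ‖u x‖)

/-- The Luxemburg norm `inf {α > 0 : ∫_{ℝ^N} Φ(|u|/α) ≤ 1}`, with value `∞` if there is no such
`α`. -/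
def luxemburgNorm {N : ℕ} {F : Type*} [NormedAddCommGroup F] (Φ : ℝ → ℝ)
    (u : EuclideanSpace ℝ (Fin N) → F) : ℝ≥0∞ :=
  ⨅ (α : ℝ) (_ : 0 < α) (_ : ∫⁻ x, ENNReal.ofReal (Φ (‖u x‖ / α)) ≤ 1), ENNReal.ofReal α

/-- Membership in the Orlicz space `L_Φ(ℝ^N)` of an N-function `Φ` with the `Δ₂`-condition. -/
def MemOrlicz {N : ℕ} (Φ : ℝ → ℝ) (u : EuclideanSpace ℝ (Fin N) → ℝ) : Prop :=
  AEStronglyMeasurable u ∧ modularOn Φ univ u < ⊤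

/-- `u` belongs to `W¹L_Φ(ℝ^N)` and has gradient `G`. Here `W¹L_Φ(ℝ^N)` is the completion of
`C_c^∞(ℝ^N)` in the norm `‖u‖_Φ + ‖∇u‖_Φ`, realised as the closure of the pairs `(φ, ∇φ)` in
`L_Φ(ℝ^N) × L_Φ(ℝ^N)^N`. -/
def MemOrliczSobolev {N : ℕ} (Φ : ℝ → ℝ) (u : EuclideanSpace ℝ (Fin N) → ℝ)
    (G : EuclideanSpace ℝ (Fin N) → EuclideanSpace ℝ (Fin N)) : Prop :=
  AEStronglyMeasurable u ∧ AEStronglyMeasurable G ∧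
    ∃ φ : ℕ → EuclideanSpace ℝ (Fin N) → ℝ,
      (∀ k, ContDiff ℝ ∞ (φ k) ∧ HasCompactSupport (φ k)) ∧
      Tendsto (fun k => luxemburgNorm Φ (fun x => φ k x - u x)) atTop (𝓝 0) ∧
      Tendsto (fun k => luxemburgNorm Φ (fun x => gradient (φ k) x - G x)) atTop (𝓝 0)

end OrliczLions

end

/-! The hypotheses on `B` reduce everything to one splitting. For σ > 0 and ε > 0 there are δ, C
with B(t) ≤ ε A(|t|) + ε A_*(σ|t|) + C·1_{|t| ≥ 3δ}: small values are controlled by A, large ones by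
A_*, and the bounded range between them by a constant. Integrating at u_n, it is enough to bound
∫A(|u_n|) and ∫A_*(σ|u_n|) uniformly and to show |{|u_n| ≥ 3δ}| → 0. By Δ₂, modular convergence then
gives norm convergence.

The A_* bound (`exists_memOrliczSobolev_const`) comes from the L¹ Gagliardo–Nirenberg–Sobolev
inequality applied to A_*(σφ)^{1-1/N}. The derivative of A_*^{1-1/N} is at most s/A⁻¹(s) with s =
A_*, and a Young inequality absorbs the gradient. A continuity argument in σ closes the estimate for
test functions, and Fatou's lemma extends it to the completion.

The measure estimate (`tendsto_measure_superlevel`) is the Lions step. By Chebyshev, vanishing makes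
{|u_n| ≥ δ} small in every ball of radius R. A Sobolev inequality localised by translated bumps
gains the factor μ^{1/N}, where μ bounds those local measures. Integrating over all translations
replaces a covering of space and yields a global bound on the superlevel set that tends to 0. -/

namespace OrliczLions

/-! ### Increasing bijections of the half-line and their inverses -/

/-- A continuous strictly increasing bijection of `[0, ∞)` (values at negative numbers are free). -/
structure IsGauge (f : ℝ → ℝ) : Prop where
  continuousOn : ContinuousOn f (Ici 0)
  strictMonoOn : StrictMonoOn f (Ici 0)
  map_zero : f 0 = 0
  tendsto : Tendsto f atTop atTop

namespace IsGauge

variable {f : ℝ → ℝ} (hf : IsGauge f)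
include hf

theorem mono {s t : ℝ} (hs : 0 ≤ s) (hst : s ≤ t) : f s ≤ f t :=
  hf.strictMonoOn.monotoneOn hs (hs.trans hst) hst

theorem lt {s t : ℝ} (hs : 0 ≤ s) (hst : s < t) : f s < f t :=
  hf.strictMonoOn hs (hs.trans hst.le) hst

theorem nonneg {t : ℝ} (ht : 0 ≤ t) : 0 ≤ f t := hf.map_zero ▸ hf.mono le_rfl ht

theorem pos {t : ℝ} (ht : 0 < t) : 0 < f t := hf.map_zero ▸ hf.lt le_rfl ht

theorem continuous_comp_abs : Continuous fun t => f |t| :=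
  hf.continuousOn.comp_continuous continuous_abs fun t => abs_nonneg t

theorem surjOn : SurjOn f (Ici 0) (Ici 0) := by
  intro y hy
  obtain ⟨T, hT0, hT⟩ := ((eventually_ge_atTop (0 : ℝ)).and
    (hf.tendsto.eventually_ge_atTop y)).exists
  have := intermediate_value_Icc hT0 (hf.continuousOn.mono Icc_subset_Ici_self)
  obtain ⟨x, hx, rfl⟩ := this ⟨by rw [hf.map_zero]; exact hy, hT⟩
  exact ⟨x, hx.1, rfl⟩

theorem inv_nonneg {s : ℝ} (hs : 0 ≤ s) : 0 ≤ invOnNonneg f s :=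
  Function.invFunOn_mem (hf.surjOn hs)

theorem apply_inv {s : ℝ} (hs : 0 ≤ s) : f (invOnNonneg f s) = s :=
  Function.invFunOn_eq (hf.surjOn hs)

theorem inv_apply {t : ℝ} (ht : 0 ≤ t) : invOnNonneg f (f t) = t :=
  hf.strictMonoOn.injOn (hf.inv_nonneg (hf.nonneg ht)) ht (hf.apply_inv (hf.nonneg ht))

theorem inv_strictMonoOn : StrictMonoOn (invOnNonneg f) (Ici 0) := by
  intro s hs t ht hst
  by_contra! h
  have := hf.mono (hf.inv_nonneg ht) h
  rw [hf.apply_inv hs, hf.apply_inv ht] at this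
  exact absurd hst this.not_gt

theorem inv_surjOn : SurjOn (invOnNonneg f) (Ici 0) (Ici 0) :=
  fun t ht => ⟨f t, hf.nonneg ht, hf.inv_apply ht⟩

theorem inv_map_zero : invOnNonneg f 0 = 0 := by
  simpa [hf.map_zero] using hf.inv_apply le_rfl

/-- A strictly monotone map onto the half-line cannot jump, which gives continuity. The lemma serves
twice: for A and for the integral defining the inverse of A_*. -/
theorem inv : IsGauge (invOnNonneg f) where
  continuousOn := by
    intro t ht
    have himg : Ici 0 ⊆ invOnNonneg f '' Ici 0 := hf.inv_surjOn
    rcases eq_or_lt_of_le (show 0 ≤ t from ht) with rfl | h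
    · refine hf.inv_strictMonoOn.continuousWithinAt_right_of_image_mem_nhdsWithin
        self_mem_nhdsWithin ?_
      rw [hf.inv_map_zero]
      exact mem_of_superset self_mem_nhdsWithin himg
    · refine (hf.inv_strictMonoOn.continuousAt_of_image_mem_nhds (Ici_mem_nhds h)
        (mem_of_superset (Ici_mem_nhds ?_) himg)).continuousWithinAt
      simpa [hf.inv_map_zero] using hf.inv_strictMonoOn (le_refl (0 : ℝ)) ht h
  strictMonoOn := hf.inv_strictMonoOn
  map_zero := hf.inv_map_zero
  tendsto := by
    refine tendsto_atTop.2 fun b => ?_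
    filter_upwards [eventually_ge_atTop (f (max b 0))] with s hs
    have h0 : 0 ≤ f (max b 0) := hf.nonneg (le_max_right _ _)
    have := hf.inv_strictMonoOn.monotoneOn (show f (max b 0) ∈ Ici 0 from h0) (h0.trans hs) hs
    rw [hf.inv_apply (le_max_right _ _)] at this
    exact (le_max_left _ _).trans this

end IsGauge

/-! ### Growth of A between two powers -/

/-- An even gauge function whose growth lies between the powers `l` and `m`. -/
structure IsGrowth (A : ℝ → ℝ) (l m : ℝ) : Prop extends IsGauge A where
  abs : ∀ t, A |t| = A t
  lower : ∀ c t : ℝ, 1 ≤ c → 0 ≤ t → c ^ l * A t ≤ A (c * t)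
  upper : ∀ c t : ℝ, 1 ≤ c → 0 ≤ t → A (c * t) ≤ c ^ m * A t

theorem continuousOn_Ici_intervalIntegral {f : ℝ → ℝ}
    (hf : ∀ t : ℝ, 0 ≤ t → IntervalIntegrable f volume 0 t) :
    ContinuousOn (fun x => ∫ s in (0 : ℝ)..x, f s) (Ici 0) := by
  intro t ht
  have ht0 : 0 ≤ t := ht
  have h1 : ContinuousOn (fun x => ∫ s in (0 : ℝ)..x, f s) (uIcc 0 (t + 1)) :=
    intervalIntegral.continuousOn_primitive_interval
      ((intervalIntegrable_iff').1 (hf (t + 1) (by linarith)))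
  rw [uIcc_of_le (by linarith)] at h1
  refine (h1 t ⟨ht0, by linarith⟩).mono_of_mem_nhdsWithin ?_
  rw [← Ici_inter_Iic]
  exact inter_mem self_mem_nhdsWithin (mem_nhdsWithin_of_mem_nhds (Iic_mem_nhds (by linarith)))

section Primitive

variable {a : ℝ → ℝ} {l m : ℝ}

theorem primitiveA_abs (t : ℝ) : primitiveA a |t| = primitiveA a t := by
  simp [primitiveA]

theorem monotoneOn_mul_self (ha0 : ∀ t : ℝ, 0 < t → 0 ≤ a t) (ha : ContDiffOn ℝ 1 a (Ioi 0))
    (ha1 : ∀ t : ℝ, 0 < t → 0 < deriv (fun s => a s * s) t) :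
    MonotoneOn (fun s => a s * s) (Ici 0) := by
  have h : StrictMonoOn (fun s => a s * s) (Ioi 0) := by
    refine strictMonoOn_of_deriv_pos (convex_Ioi 0) (ha.continuousOn.mul continuousOn_id) ?_
    simpa using ha1
  intro s hs t ht hst
  -- At s = 0 the product vanishes whatever the value `a 0` is.
  rcases eq_or_lt_of_le (show 0 ≤ s from hs) with rfl | hs'
  · rcases eq_or_lt_of_le hst with rfl | ht'
    · exact le_rfl
    · simpa using mul_nonneg (ha0 t ht') ht'.le
  · exact h.monotoneOn hs' (hs'.trans_le hst) hst

theorem intervalIntegrable_mul_self (ha0 : ∀ t : ℝ, 0 < t → 0 ≤ a t)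
    (ha : ContDiffOn ℝ 1 a (Ioi 0))
    (ha1 : ∀ t : ℝ, 0 < t → 0 < deriv (fun s => a s * s) t) {t : ℝ} (ht : 0 ≤ t) :
    IntervalIntegrable (fun s => a s * s) volume 0 t := by
  apply MonotoneOn.intervalIntegrable
  rw [uIcc_of_le ht]
  exact (monotoneOn_mul_self ha0 ha ha1).mono Icc_subset_Ici_self

theorem hasDerivAt_primitiveA (ha0 : ∀ t : ℝ, 0 < t → 0 ≤ a t)
    (ha : ContDiffOn ℝ 1 a (Ioi 0))
    (ha1 : ∀ t : ℝ, 0 < t → 0 < deriv (fun s => a s * s) t) {t : ℝ} (ht : 0 < t) :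
    HasDerivAt (primitiveA a) (a t * t) t := by
  have hc : ContinuousOn (fun s => a s * s) (Ioi 0) := ha.continuousOn.mul continuousOn_id
  have := intervalIntegral.integral_hasDerivAt_right
    (intervalIntegrable_mul_self ha0 ha ha1 ht.le)
    (hc.stronglyMeasurableAtFilter isOpen_Ioi t ht) (hc.continuousAt (Ioi_mem_nhds ht))
  refine this.congr_of_eventuallyEq ?_
  filter_upwards [Ioi_mem_nhds ht] with s hs
  simp [primitiveA, abs_of_pos (show 0 < s from hs)]

theorem primitiveA_pos (ha0 : ∀ t : ℝ, 0 < t → 0 ≤ a t) (hl : 1 < l)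
    (ha2 : ∀ t : ℝ, t ≠ 0 → l ≤ a |t| * t ^ 2 / primitiveA a t) {t : ℝ} (ht : 0 < t) :
    0 < primitiveA a t := by
  have h0 : 0 ≤ primitiveA a t := by
    refine intervalIntegral.integral_nonneg (abs_nonneg t) fun s hs => ?_
    rcases eq_or_lt_of_le hs.1 with rfl | h
    · simp
    · exact mul_nonneg (ha0 s h) h.le
  -- Were A(t) zero, the quotient would take the default value 0, contradicting l > 1.
  refine lt_of_le_of_ne h0 fun h => ?_
  have := ha2 t ht.ne'
  rw [← h, div_zero] at this
  linarith

/-- The derivative of A(t) t^{-r} is (a(t)t² − rA(t)) t^{-r-1}, so the two-sided bound makes this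
function increasing for r = l and decreasing for r = m. -/
theorem isGrowth_primitiveA (ha0 : ∀ t : ℝ, 0 < t → 0 ≤ a t)
    (ha : ContDiffOn ℝ 1 a (Ioi 0))
    (ha1 : ∀ t : ℝ, 0 < t → 0 < deriv (fun s => a s * s) t) (hl : 1 < l)
    (ha2 : ∀ t : ℝ, t ≠ 0 →
      l ≤ a |t| * t ^ 2 / primitiveA a t ∧ a |t| * t ^ 2 / primitiveA a t ≤ m) :
    IsGrowth (primitiveA a) l m := by
  have hpos : ∀ {t : ℝ}, 0 < t → 0 < primitiveA a t :=
    fun ht => primitiveA_pos ha0 hl (fun t ht => (ha2 t ht).1) ht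
  have hder : ∀ {t : ℝ}, 0 < t → HasDerivAt (primitiveA a) (a t * t) t :=
    fun ht => hasDerivAt_primitiveA ha0 ha ha1 ht
  have hzero : primitiveA a 0 = 0 := by simp [primitiveA]
  have hb : ∀ {t : ℝ}, 0 < t → l * primitiveA a t ≤ a t * t * t ∧
      a t * t * t ≤ m * primitiveA a t := by
    intro t ht
    have := ha2 t ht.ne'
    rw [abs_of_pos ht, le_div_iff₀ (hpos ht), div_le_iff₀ (hpos ht)] at this
    constructor <;> nlinarith [this.1, this.2]
  have hcont : ContinuousOn (primitiveA a) (Ici 0) :=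
    (continuousOn_Ici_intervalIntegral fun t ht =>
      intervalIntegrable_mul_self ha0 ha ha1 ht).congr fun x hx => by
        simp [primitiveA, abs_of_nonneg (show 0 ≤ x from hx)]
  have hscale : ∀ {c t r : ℝ}, 1 ≤ c → 0 < t → (c * t) ^ r = c ^ r * t ^ r :=
    fun hc ht => Real.mul_rpow (by linarith) ht.le
  have hpd : ∀ (r : ℝ) {t : ℝ}, 0 < t → HasDerivAt (fun t => primitiveA a t * t ^ (-r))
      (a t * t * t ^ (-r) + primitiveA a t * (-r * t ^ (-r - 1))) t := fun r t ht =>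
    (hder ht).mul (Real.hasDerivAt_rpow_const (Or.inl ht.ne'))
  have hpd' : ∀ (r : ℝ) {t : ℝ}, 0 < t →
      a t * t * t ^ (-r) + primitiveA a t * (-r * t ^ (-r - 1)) =
        (a t * t * t - r * primitiveA a t) * t ^ (-r - 1) := by
    intro r t ht
    have : t ^ (-r) = t ^ (-r - 1) * t := by
      rw [← Real.rpow_add_one ht.ne']; congr 1; ring
    rw [this]; ring
  have hlow : MonotoneOn (fun t => primitiveA a t * t ^ (-l)) (Ioi 0) := by
    refine monotoneOn_of_deriv_nonneg (convex_Ioi 0)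
      (fun t ht => (hpd l ht).continuousAt.continuousWithinAt) ?_ ?_
    · intro t ht
      rw [interior_Ioi] at ht
      exact (hpd l ht).differentiableAt.differentiableWithinAt
    · intro t ht
      rw [interior_Ioi] at ht
      rw [(hpd l ht).deriv, hpd' l ht]
      exact mul_nonneg (sub_nonneg.2 (hb ht).1) (Real.rpow_nonneg (le_of_lt ht) _)
  have hup : AntitoneOn (fun t => primitiveA a t * t ^ (-m)) (Ioi 0) := by
    refine antitoneOn_of_deriv_nonpos (convex_Ioi 0)
      (fun t ht => (hpd m ht).continuousAt.continuousWithinAt) ?_ ?_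
    · intro t ht
      rw [interior_Ioi] at ht
      exact (hpd m ht).differentiableAt.differentiableWithinAt
    · intro t ht
      rw [interior_Ioi] at ht
      rw [(hpd m ht).deriv, hpd' m ht]
      exact mul_nonpos_of_nonpos_of_nonneg (sub_nonpos.2 (hb ht).2)
        (Real.rpow_nonneg (le_of_lt ht) _)
  have hlower : ∀ c t : ℝ, 1 ≤ c → 0 ≤ t → c ^ l * primitiveA a t ≤ primitiveA a (c * t) := by
    intro c t hc ht
    rcases eq_or_lt_of_le ht with rfl | ht
    · simp [hzero]
    have hct : 0 < c * t := by positivity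
    have := hlow (show t ∈ Ioi 0 from ht) (show c * t ∈ Ioi 0 from hct) (by nlinarith)
    simp only [Real.rpow_neg ht.le, Real.rpow_neg hct.le, hscale hc ht] at this
    have h1 : 0 < c ^ l := by positivity
    have h2 : 0 < t ^ l := by positivity
    rw [← div_eq_mul_inv, ← div_eq_mul_inv, div_le_div_iff₀ h2 (by positivity)] at this
    nlinarith
  refine ⟨⟨hcont, ?_, hzero, ?_⟩, primitiveA_abs, hlower, ?_⟩
  · refine strictMonoOn_of_deriv_pos (convex_Ici 0) hcont fun t ht => ?_
    rw [interior_Ici] at ht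
    rw [(hder ht).deriv]
    have := (hb ht).1
    have h1 := hpos ht
    have h2 : (0 : ℝ) < t := ht
    by_contra! h
    nlinarith
  · have h1 : ∀ᶠ c : ℝ in atTop, c * primitiveA a 1 ≤ primitiveA a c := by
      filter_upwards [eventually_ge_atTop (1 : ℝ)] with c hc
      have := hlower c 1 hc zero_le_one
      rw [mul_one] at this
      refine le_trans (mul_le_mul_of_nonneg_right ?_ (hpos one_pos).le) this
      simpa using Real.rpow_le_rpow_of_exponent_le hc hl.le
    exact tendsto_atTop_mono' _ h1 (tendsto_id.atTop_mul_const (hpos one_pos))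
  · intro c t hc ht
    rcases eq_or_lt_of_le ht with rfl | ht
    · simp [hzero]
    have hct : 0 < c * t := by positivity
    have := hup (show t ∈ Ioi 0 from ht) (show c * t ∈ Ioi 0 from hct) (by nlinarith)
    simp only [Real.rpow_neg ht.le, Real.rpow_neg hct.le, hscale hc ht] at this
    have h1 : 0 < c ^ m := by positivity
    have h2 : 0 < t ^ m := by positivity
    rw [← div_eq_mul_inv, ← div_eq_mul_inv, div_le_div_iff₀ (by positivity) h2] at this
    nlinarith

end Primitive

/-! ### The inverse of A and the Sobolev conjugate A_* -/

namespace IsGrowth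

variable {A : ℝ → ℝ} {l m : ℝ} (hA : IsGrowth A l m)
include hA

theorem mul_le (hl : 1 ≤ l) {c t : ℝ} (hc : 1 ≤ c) (ht : 0 ≤ t) : c * A t ≤ A (c * t) := by
  refine le_trans (mul_le_mul_of_nonneg_right ?_ (hA.nonneg ht)) (hA.lower c t hc ht)
  simpa using Real.rpow_le_rpow_of_exponent_le hc hl

theorem continuous : Continuous A := by
  simpa only [hA.abs] using hA.continuous_comp_abs

theorem nonneg' (t : ℝ) : 0 ≤ A t := hA.abs t ▸ hA.nonneg (abs_nonneg t)

/-- A form of Young's inequality which avoids the complementary function. -/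
theorem div_inv_mul_le (hl : 1 ≤ l) {s ρ η : ℝ} (hs : 0 ≤ s) (hη : 0 < η) :
    s / invOnNonneg A s * ρ ≤ η * (s + A (ρ / η)) := by
  have hA0 := hA.nonneg' (ρ / η)
  rcases eq_or_lt_of_le hs with rfl | hs
  · simp only [zero_div, zero_mul, zero_add]; positivity
  have hq : 0 < invOnNonneg A s := hA.inv.pos hs
  have hAq := hA.apply_inv hs.le
  set q := invOnNonneg A s
  -- With q = A⁻¹(s): if ρ ≤ ηq the product is at most ηs; otherwise ρ/(ηq) ≥ 1 and superlinearity
  -- gives (ρ/(ηq))·s ≤ A(ρ/η).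
  rcases le_total ρ (η * q) with h | h
  · calc s / q * ρ ≤ s / q * (η * q) := by gcongr
      _ = η * s := by field_simp
      _ ≤ _ := by nlinarith
  · have h1 : 1 ≤ ρ / η / q := by
      rw [div_div, one_le_div (by positivity)]; exact h
    have h2 := hA.mul_le hl h1 hq.le
    rw [div_mul_cancel₀ _ hq.ne', hAq] at h2
    calc s / q * ρ = η * (ρ / η / q * s) := by field_simp
      _ ≤ η * A (ρ / η) := by gcongr
      _ ≤ _ := by nlinarith

theorem rpow_mul_apply_one_le {t : ℝ} (ht : 0 ≤ t) (ht1 : t ≤ 1) (hm : 0 < m) :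
    t ^ m * A 1 ≤ A t := by
  rcases eq_or_lt_of_le ht with rfl | ht
  · simp [Real.zero_rpow hm.ne', hA.map_zero]
  have := hA.upper t⁻¹ t ((one_le_inv₀ ht).2 ht1) ht.le
  rw [inv_mul_cancel₀ ht.ne', Real.inv_rpow ht.le] at this
  calc t ^ m * A 1 ≤ t ^ m * ((t ^ m)⁻¹ * A t) := by gcongr
    _ = A t := by field_simp

theorem apply_le_rpow {t : ℝ} (ht : 0 ≤ t) (ht1 : t ≤ 1) (hl : 0 < l) :
    A t ≤ t ^ l * A 1 := by
  rcases eq_or_lt_of_le ht with rfl | ht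
  · simp [Real.zero_rpow hl.ne', hA.map_zero]
  have := hA.lower t⁻¹ t ((one_le_inv₀ ht).2 ht1) ht.le
  rw [inv_mul_cancel₀ ht.ne', Real.inv_rpow ht.le] at this
  calc A t = t ^ l * ((t ^ l)⁻¹ * A t) := by field_simp
    _ ≤ t ^ l * A 1 := by gcongr

theorem inv_le (hl : 1 ≤ l) (hm : 0 < m) {s : ℝ} (hs : 0 ≤ s) :
    invOnNonneg A s ≤ (s / A 1) ^ m⁻¹ + s / A 1 := by
  have h1 := hA.pos one_pos
  have hq := hA.inv_nonneg hs
  have hAq := hA.apply_inv hs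
  set q := invOnNonneg A s
  rcases le_total q 1 with h | h
  · have := hA.rpow_mul_apply_one_le hq h hm
    rw [hAq, ← le_div_iff₀ h1] at this
    have h2 := Real.rpow_le_rpow (by positivity) this (inv_pos.2 hm).le
    rw [Real.rpow_rpow_inv hq hm.ne'] at h2
    have : 0 ≤ s / A 1 := by positivity
    linarith
  · have := hA.mul_le hl h zero_le_one
    rw [mul_one, hAq, ← le_div_iff₀ h1] at this
    have : 0 ≤ (s / A 1) ^ m⁻¹ := by positivity
    linarith

theorem le_inv (hm : 0 < m) {s : ℝ} (hs : A 1 ≤ s) :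
    (s / A 1) ^ m⁻¹ ≤ invOnNonneg A s := by
  have h1 := hA.pos one_pos
  have hs0 : 0 ≤ s := h1.le.trans hs
  have h : 1 ≤ invOnNonneg A s := by
    rw [← hA.inv_apply zero_le_one]
    exact hA.inv.mono h1.le hs
  have hAq := hA.apply_inv hs0
  set q := invOnNonneg A s
  have := hA.upper q 1 h zero_le_one
  rw [mul_one, hAq, ← div_le_iff₀ h1] at this
  have h2 := Real.rpow_le_rpow (by positivity) this (inv_pos.2 hm).le
  rwa [Real.rpow_rpow_inv (by linarith) hm.ne'] at h2

theorem continuousOn_sobolevIntegrand (N : ℕ) :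
    ContinuousOn (fun s => invOnNonneg A s / s ^ (((N : ℝ) + 1) / (N : ℝ))) (Ioi 0) := by
  refine (hA.inv.continuousOn.mono Ioi_subset_Ici_self).div
    (continuousOn_id.rpow_const fun x hx => Or.inl (ne_of_gt hx)) fun x hx => ?_
  exact (Real.rpow_pos_of_pos hx _).ne'

/-- The bound on A⁻¹ dominates the integrand by powers of exponents 1/m − 1/N − 1 and −1/N, both
above −1 because 1 < m < N. -/
theorem intervalIntegrable_sobolevIntegrand {N : ℕ} (hl : 1 ≤ l) (hm : 1 < m) (hmN : m < N)
    {t : ℝ} (ht : 0 ≤ t) :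
    IntervalIntegrable (fun s => invOnNonneg A s / s ^ (((N : ℝ) + 1) / (N : ℝ)))
      volume 0 t := by
  have hm0 : 0 < m := by linarith
  have hN : (0 : ℝ) < N := hm0.trans hmN
  have h1 := hA.pos one_pos
  have hinv : (N : ℝ)⁻¹ < m⁻¹ := by gcongr
  have hN1 : (N : ℝ)⁻¹ < 1 := inv_lt_one_of_one_lt₀ (hm.trans hmN)
  have hexp : ((N : ℝ) + 1) / N = 1 + (N : ℝ)⁻¹ := by field_simp
  have hi1 : IntervalIntegrable (fun s : ℝ => (A 1 ^ m⁻¹)⁻¹ * s ^ (m⁻¹ - (1 + (N : ℝ)⁻¹)) +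
      (A 1)⁻¹ * s ^ (1 - (1 + (N : ℝ)⁻¹))) volume 0 t :=
    ((intervalIntegral.intervalIntegrable_rpow' (by linarith)).const_mul _).add
      ((intervalIntegral.intervalIntegrable_rpow' (by linarith)).const_mul _)
  refine hi1.mono_fun ?_ ?_
  · rw [uIoc_of_le ht]
    exact ((hA.continuousOn_sobolevIntegrand N).mono Ioc_subset_Ioi_self).aestronglyMeasurable
      measurableSet_Ioc
  · rw [uIoc_of_le ht]
    refine (ae_restrict_iff' measurableSet_Ioc).2 (Eventually.of_forall fun s hs => ?_)
    have hs0 : 0 < s := hs.1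
    have hq := hA.inv_nonneg hs0.le
    have hle := hA.inv_le hl hm0 hs0.le
    beta_reduce
    rw [Real.norm_of_nonneg (by positivity), Real.norm_of_nonneg (by positivity), hexp,
      Real.rpow_sub hs0, Real.rpow_sub hs0, Real.rpow_one]
    rw [Real.div_rpow hs0.le h1.le] at hle
    calc _ ≤ (s ^ m⁻¹ / A 1 ^ m⁻¹ + s / A 1) / s ^ (1 + (N : ℝ)⁻¹) := by gcongr
      _ = _ := by ring

theorem sobolevIntegrand_pos {N : ℕ} {s : ℝ} (hs : 0 < s) :
    0 < invOnNonneg A s / s ^ (((N : ℝ) + 1) / (N : ℝ)) :=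
  div_pos (hA.inv.pos hs) (Real.rpow_pos_of_pos hs _)

theorem hasDerivAt_sobolevConjugateInv {N : ℕ} (hl : 1 ≤ l) (hm : 1 < m) (hmN : m < N)
    {t : ℝ} (ht : 0 < t) :
    HasDerivAt (sobolevConjugateInv N A)
      (invOnNonneg A t / t ^ (((N : ℝ) + 1) / (N : ℝ))) t :=
  intervalIntegral.integral_hasDerivAt_right
    (hA.intervalIntegrable_sobolevIntegrand hl hm hmN ht.le)
    ((hA.continuousOn_sobolevIntegrand N).stronglyMeasurableAtFilter isOpen_Ioi t ht)
    ((hA.continuousOn_sobolevIntegrand N).continuousAt (Ioi_mem_nhds ht))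

/-- Beyond A(1) the integrand is at least a constant times s^{1/m-1/N}/s, and m < N lets the
numerator be bounded below by its value at A(1). Logarithmic divergence suffices to make the
function onto. -/
theorem le_sobolevConjugateInv {N : ℕ} (hl : 1 ≤ l) (hm : 1 < m) (hmN : m < N)
    {t : ℝ} (ht : A 1 ≤ t) :
    (A 1 ^ m⁻¹)⁻¹ * (A 1 ^ (m⁻¹ - (N : ℝ)⁻¹)) * Real.log (t / A 1) ≤
      sobolevConjugateInv N A t := by
  have hm0 : 0 < m := by linarith
  have hN : (0 : ℝ) < N := hm0.trans hmN
  have h1 := hA.pos one_pos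
  have hinv : (N : ℝ)⁻¹ < m⁻¹ := by gcongr
  have hexp : ((N : ℝ) + 1) / N = 1 + (N : ℝ)⁻¹ := by field_simp
  have h01 := hA.intervalIntegrable_sobolevIntegrand hl hm hmN h1.le
  have h0t := hA.intervalIntegrable_sobolevIntegrand hl hm hmN (h1.le.trans ht)
  have h1t := h01.symm.trans h0t
  have hsplit := intervalIntegral.integral_add_adjacent_intervals h01 h1t
  have hnn : 0 ≤ ∫ s in (0 : ℝ)..A 1, invOnNonneg A s / s ^ (((N : ℝ) + 1) / (N : ℝ)) := by
    refine intervalIntegral.integral_nonneg h1.le fun s hs => ?_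
    exact div_nonneg (hA.inv_nonneg hs.1) (Real.rpow_nonneg hs.1 _)
  have hint : IntervalIntegrable (fun s : ℝ => s⁻¹) volume (A 1) t := by
    rw [intervalIntegrable_inv_iff]
    right
    rw [uIcc_of_le ht]
    exact fun h => absurd h.1 h1.not_ge
  have hmono : ∫ s in (A 1)..t, (A 1 ^ m⁻¹)⁻¹ * (A 1 ^ (m⁻¹ - (N : ℝ)⁻¹)) * s⁻¹ ≤
      ∫ s in (A 1)..t, invOnNonneg A s / s ^ (((N : ℝ) + 1) / (N : ℝ)) := by
    refine intervalIntegral.integral_mono_on ht (hint.const_mul _) h1t fun s hs => ?_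
    have hs0 : 0 < s := h1.trans_le hs.1
    have hle := hA.le_inv hm0 hs.1
    rw [Real.div_rpow hs0.le h1.le] at hle
    have hp : A 1 ^ (m⁻¹ - (N : ℝ)⁻¹) ≤ s ^ (m⁻¹ - (N : ℝ)⁻¹) :=
      Real.rpow_le_rpow h1.le hs.1 (by linarith)
    rw [hexp, le_div_iff₀ (by positivity)]
    refine le_trans ?_ hle
    calc (A 1 ^ m⁻¹)⁻¹ * (A 1 ^ (m⁻¹ - (N : ℝ)⁻¹)) * s⁻¹ * s ^ (1 + (N : ℝ)⁻¹)
        ≤ (A 1 ^ m⁻¹)⁻¹ * (s ^ (m⁻¹ - (N : ℝ)⁻¹)) * s⁻¹ * s ^ (1 + (N : ℝ)⁻¹) := by gcongr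
      _ = s ^ m⁻¹ / A 1 ^ m⁻¹ := by
        rw [Real.rpow_sub hs0, Real.rpow_add hs0, Real.rpow_one]; field_simp
  rw [intervalIntegral.integral_const_mul, integral_inv_of_pos h1 (h1.trans_le ht)] at hmono
  unfold sobolevConjugateInv
  linarith

theorem isGauge_sobolevConjugateInv {N : ℕ} (hl : 1 ≤ l) (hm : 1 < m) (hmN : m < N) :
    IsGauge (sobolevConjugateInv N A) := by
  have h1 := hA.pos one_pos
  have hc : ContinuousOn (sobolevConjugateInv N A) (Ici 0) :=
    continuousOn_Ici_intervalIntegral fun t ht =>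
      hA.intervalIntegrable_sobolevIntegrand hl hm hmN ht
  refine ⟨hc, ?_, by simp [sobolevConjugateInv], ?_⟩
  · refine strictMonoOn_of_deriv_pos (convex_Ici 0) hc fun t ht => ?_
    rw [interior_Ici] at ht
    rw [(hA.hasDerivAt_sobolevConjugateInv hl hm hmN ht).deriv]
    exact hA.sobolevIntegrand_pos ht
  · refine tendsto_atTop_mono' _ ((eventually_ge_atTop (A 1)).mono fun t ht =>
      hA.le_sobolevConjugateInv hl hm hmN ht) ?_
    refine Tendsto.const_mul_atTop (by positivity) ?_
    exact Real.tendsto_log_atTop.comp (tendsto_id.atTop_div_const h1)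

theorem hasDerivAt_inv_sobolevConjugateInv {N : ℕ} (hl : 1 ≤ l) (hm : 1 < m) (hmN : m < N)
    {t : ℝ} (ht : 0 < t) {s : ℝ} (hs : s = invOnNonneg (sobolevConjugateInv N A) t) :
    HasDerivAt (invOnNonneg (sobolevConjugateInv N A))
      (invOnNonneg A s / s ^ (((N : ℝ) + 1) / (N : ℝ)))⁻¹ t := by
  have hH := hA.isGauge_sobolevConjugateInv hl hm hmN
  have hs0 : 0 < s := hs ▸ hH.inv.pos ht
  have hc : ContinuousAt (invOnNonneg (sobolevConjugateInv N A)) t :=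
    hH.inv.continuousOn.continuousAt (Ici_mem_nhds ht)
  refine HasDerivAt.of_local_left_inverse (f := sobolevConjugateInv N A) hc
    (hs ▸ hA.hasDerivAt_sobolevConjugateInv hl hm hmN hs0) (hA.sobolevIntegrand_pos hs0).ne' ?_
  filter_upwards [Ioi_mem_nhds ht] with y hy
  exact hH.apply_inv (le_of_lt hy)

/-- Only s = 0 is delicate, where the quotient is 0 by convention. For q = A⁻¹(s) ≤ 1 one has s ≤
q^l A(1), so s/q ≤ q^{l-1} A(1), which tends to 0 since l > 1. -/
theorem continuousOn_div_inv (hl : 1 < l) : ContinuousOn (fun s => s / invOnNonneg A s) (Ici 0) := by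
  intro s hs
  rcases eq_or_lt_of_le (show 0 ≤ s from hs) with rfl | hs
  · have hq : Tendsto (fun s => invOnNonneg A s ^ (l - 1) * A 1) (𝓝[Ici 0] 0) (𝓝 0) := by
      have h1 : ContinuousWithinAt (fun s => invOnNonneg A s ^ (l - 1) * A 1) (Ici 0) 0 :=
        ((hA.inv.continuousOn 0 self_mem_Ici).rpow_const (Or.inr (by linarith))).mul_const _
      have h2 := h1.tendsto
      rwa [hA.inv_map_zero, Real.zero_rpow (by linarith), zero_mul] at h2
    have hev : ∀ᶠ s in 𝓝[Ici 0] (0 : ℝ), s ≤ A 1 :=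
      mem_nhdsWithin_of_mem_nhds (Iic_mem_nhds (hA.pos one_pos))
    rw [ContinuousWithinAt, zero_div]
    refine tendsto_of_tendsto_of_tendsto_of_le_of_le' tendsto_const_nhds hq ?_ ?_
    · filter_upwards [self_mem_nhdsWithin] with s hs
      exact div_nonneg hs (hA.inv_nonneg hs)
    · filter_upwards [self_mem_nhdsWithin, hev] with s hs hs1
      have hs0 : 0 ≤ s := hs
      rcases eq_or_lt_of_le hs0 with rfl | hs0
      · rw [zero_div, hA.inv_map_zero, Real.zero_rpow (by linarith), zero_mul]
      have hq := hA.inv.pos hs0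
      have hq1 : invOnNonneg A s ≤ 1 := by
        rw [← hA.inv_apply zero_le_one]; exact hA.inv.mono hs0.le hs1
      have := hA.apply_le_rpow hq.le hq1 (by linarith)
      rw [hA.apply_inv hs0.le] at this
      rw [div_le_iff₀ hq]
      refine this.trans (le_of_eq ?_)
      rw [Real.rpow_sub_one hq.ne']
      field_simp
  · exact (continuousAt_id.div (hA.inv.continuousOn.continuousAt (Ici_mem_nhds hs))
      (hA.inv.pos hs).ne').continuousWithinAt

theorem continuous_sobolevConjugate {N : ℕ} (hl : 1 ≤ l) (hm : 1 < m) (hmN : m < N) :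
    Continuous (sobolevConjugate N A) :=
  (hA.isGauge_sobolevConjugateInv hl hm hmN).inv.continuous_comp_abs

theorem sobolevConjugate_nonneg {N : ℕ} (hl : 1 ≤ l) (hm : 1 < m) (hmN : m < N) (t : ℝ) :
    0 ≤ sobolevConjugate N A t :=
  (hA.isGauge_sobolevConjugateInv hl hm hmN).inv_nonneg (abs_nonneg t)

theorem sobolevConjugate_zero {N : ℕ} (hl : 1 ≤ l) (hm : 1 < m) (hmN : m < N) :
    sobolevConjugate N A 0 = 0 := by
  simp [sobolevConjugate, (hA.isGauge_sobolevConjugateInv hl hm hmN).inv_map_zero]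

/-- The sign jumps only at 0, where the other factor vanishes. -/
theorem continuous_deriv_sobolevConjugate_rpow {N : ℕ} (hl : 1 < l) (hm : 1 < m) (hmN : m < N) :
    Continuous fun t : ℝ => (1 - (N : ℝ)⁻¹) *
      (sobolevConjugate N A t / invOnNonneg A (sobolevConjugate N A t)) *
        (SignType.sign t : ℝ) := by
  have hK : Continuous fun t => (1 - (N : ℝ)⁻¹) *
      (sobolevConjugate N A t / invOnNonneg A (sobolevConjugate N A t)) :=
    ((hA.continuousOn_div_inv hl).comp_continuous
      (hA.continuous_sobolevConjugate hl.le hm hmN) fun t =>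
        hA.sobolevConjugate_nonneg hl.le hm hmN t).const_mul _
  have hK0 : (1 - (N : ℝ)⁻¹) *
      (sobolevConjugate N A 0 / invOnNonneg A (sobolevConjugate N A 0)) = 0 := by
    simp [hA.sobolevConjugate_zero hl.le hm hmN]
  refine (hK.if_le hK.neg continuous_const continuous_id
    (f := fun _ => (0 : ℝ)) (g := id) fun t ht => ?_).congr fun t => ?_
  · obtain rfl : (0 : ℝ) = t := ht
    rw [Pi.neg_apply, hK0, neg_zero]
  · rcases lt_trichotomy t 0 with h | rfl | h
    · simp [h, h.not_ge]
    · simp [hK0]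
    · simp [h, h.le]

/-- With s = A_*(t), A_*' = s^{1+1/N}/A⁻¹(s). The exponent 1 − 1/N is the one that cancels the
powers of s and leaves s/A⁻¹(s), the quantity in the Young inequality. -/
theorem hasDerivAt_sobolevConjugate_rpow {N : ℕ} (hl : 1 < l) (hm : 1 < m) (hmN : m < N)
    (t : ℝ) :
    HasDerivAt (fun t => sobolevConjugate N A t ^ (1 - (N : ℝ)⁻¹))
      ((1 - (N : ℝ)⁻¹) * (sobolevConjugate N A t / invOnNonneg A (sobolevConjugate N A t)) *
        SignType.sign t) t := by
  have hH := hA.isGauge_sobolevConjugateInv hl.le hm hmN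
  have hm0 : 0 < m := by linarith
  have hN : (0 : ℝ) < N := hm0.trans hmN
  have hN1 : (N : ℝ)⁻¹ < 1 := inv_lt_one_of_one_lt₀ (hm.trans hmN)
  have hpos : ∀ t : ℝ, 0 < t →
      HasDerivAt (fun t => sobolevConjugate N A t ^ (1 - (N : ℝ)⁻¹))
      ((1 - (N : ℝ)⁻¹) *
        (sobolevConjugate N A t / invOnNonneg A (sobolevConjugate N A t))) t := by
    intro t ht
    have hS : sobolevConjugate N A t = invOnNonneg (sobolevConjugateInv N A) t := by
      rw [sobolevConjugate, abs_of_pos ht]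
    have hd := hA.hasDerivAt_inv_sobolevConjugateInv hl.le hm hmN ht hS
    have hd' : HasDerivAt (sobolevConjugate N A) _ t :=
      hd.congr_of_eventuallyEq (by
        filter_upwards [Ioi_mem_nhds ht] with y hy
        rw [sobolevConjugate, abs_of_pos hy])
    have hs0 : 0 < sobolevConjugate N A t := hS ▸ hH.inv.pos ht
    have := hd'.rpow_const (p := 1 - (N : ℝ)⁻¹) (Or.inl hs0.ne')
    refine this.congr_deriv ?_
    have hq := hA.inv.pos hs0
    generalize sobolevConjugate N A t = s at *
    rw [show 1 - (N : ℝ)⁻¹ - 1 = -(N : ℝ)⁻¹ by ring, Real.rpow_neg hs0.le,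
      show ((N : ℝ) + 1) / N = 1 + (N : ℝ)⁻¹ by field_simp, Real.rpow_add hs0, Real.rpow_one]
    field_simp
  have heven : ∀ t, sobolevConjugate N A (-t) = sobolevConjugate N A t := fun t => by
    simp [sobolevConjugate]
  have hcont := hA.continuous_sobolevConjugate (N := N) hl.le hm hmN
  -- Differentiability at 0 follows from that away from 0, as the function and the candidate
  -- derivative are continuous there.
  refine hasDerivAt_of_hasDerivAt_of_ne' (x := 0) (g := fun t => (1 - (N : ℝ)⁻¹) *
    (sobolevConjugate N A t / invOnNonneg A (sobolevConjugate N A t)) * SignType.sign t)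
    (fun t ht => ?_) ?_ ?_ t
  · rcases lt_or_gt_of_ne ht with ht | ht
    · have := (hpos (-t) (by linarith)).scomp t (hasDerivAt_neg t)
      simp only [Function.comp_def, heven] at this
      refine this.congr_deriv ?_
      simp [sign_neg ht]
    · simpa [sign_pos ht] using hpos t ht
  · exact hcont.continuousAt.rpow_const (Or.inr (by linarith))
  · exact (hA.continuous_deriv_sobolevConjugate_rpow hl hm hmN).continuousAt

theorem contDiff_sobolevConjugate_rpow {N : ℕ} (hl : 1 < l) (hm : 1 < m) (hmN : m < N) :
    ContDiff ℝ 1 (fun t => sobolevConjugate N A t ^ (1 - (N : ℝ)⁻¹)) := by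
  have hd := hA.hasDerivAt_sobolevConjugate_rpow (N := N) hl hm hmN
  refine contDiff_one_iff_deriv.2 ⟨fun t => (hd t).differentiableAt, ?_⟩
  rw [funext fun t => (hd t).deriv]
  exact hA.continuous_deriv_sobolevConjugate_rpow hl hm hmN

theorem abs_deriv_sobolevConjugate_rpow_le {N : ℕ} (hl : 1 < l) (hm : 1 < m) (hmN : m < N)
    (t : ℝ) :
    |deriv (fun t => sobolevConjugate N A t ^ (1 - (N : ℝ)⁻¹)) t| ≤
      sobolevConjugate N A t / invOnNonneg A (sobolevConjugate N A t) := by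
  have hN1 : (N : ℝ)⁻¹ < 1 := inv_lt_one_of_one_lt₀ (hm.trans hmN)
  have hN0 : (0 : ℝ) ≤ (N : ℝ)⁻¹ := by positivity
  have hS := hA.sobolevConjugate_nonneg (N := N) hl.le hm hmN t
  have hK : 0 ≤ sobolevConjugate N A t / invOnNonneg A (sobolevConjugate N A t) :=
    div_nonneg hS (hA.inv_nonneg hS)
  rw [(hA.hasDerivAt_sobolevConjugate_rpow hl hm hmN t).deriv, abs_mul, abs_mul, abs_of_nonneg hK,
    abs_of_nonneg (by linarith : 0 ≤ 1 - (N : ℝ)⁻¹)]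
  have : |((SignType.sign t : SignType) : ℝ)| ≤ 1 := by
    rcases lt_trichotomy t 0 with h | h | h <;> simp [h]
  calc _ ≤ 1 * (sobolevConjugate N A t / invOnNonneg A (sobolevConjugate N A t)) * 1 := by
        gcongr; linarith
    _ = _ := by ring

end IsGrowth

/-! ### Modulars and Luxemburg norms -/

section Modular

variable {N : ℕ} {F : Type*} [NormedAddCommGroup F]

/-- The strict inequality supplies an admissible α ≤ c, so the infimum need not be attained. -/
theorem lintegral_le_one_of_luxemburgNorm_lt {Φ : ℝ → ℝ} (hΦ : MonotoneOn Φ (Ici 0))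
    {u : EuclideanSpace ℝ (Fin N) → F} {c : ℝ} (h : luxemburgNorm Φ u < ENNReal.ofReal c) :
    ∫⁻ x, ENNReal.ofReal (Φ (‖u x‖ / c)) ≤ 1 := by
  simp only [luxemburgNorm, iInf_lt_iff] at h
  obtain ⟨α, hα, h1, hlt⟩ := h
  have hαc : α ≤ c := (ENNReal.ofReal_lt_ofReal_iff'.1 hlt).1.le
  refine le_trans (lintegral_mono fun x => ENNReal.ofReal_le_ofReal ?_) h1
  have hc : 0 < c := hα.trans_le hαc
  exact hΦ (div_nonneg (norm_nonneg _) hc.le) (div_nonneg (norm_nonneg _) hα.le)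
    (by gcongr)

theorem luxemburgNorm_le {Φ : ℝ → ℝ} {u : EuclideanSpace ℝ (Fin N) → F} {c : ℝ} (hc : 0 < c)
    (h : ∫⁻ x, ENNReal.ofReal (Φ (‖u x‖ / c)) ≤ 1) : luxemburgNorm Φ u ≤ ENNReal.ofReal c :=
  iInf_le_of_le c (iInf_le_of_le hc (iInf_le_of_le h le_rfl))

namespace IsGrowth

variable {A : ℝ → ℝ} {l m : ℝ} (hA : IsGrowth A l m)
include hA

theorem monotoneOn : MonotoneOn A (Ici 0) := hA.strictMonoOn.monotoneOn

theorem apply_mean_le {s t : ℝ} (hs : 0 ≤ s) (ht : 0 ≤ t) : A ((s + t) / 2) ≤ A s + A t := by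
  rcases le_total s t with h | h
  · have := hA.mono (by positivity : 0 ≤ (s + t) / 2) (by linarith : (s + t) / 2 ≤ t)
    linarith [hA.nonneg hs]
  · have := hA.mono (by positivity : 0 ≤ (s + t) / 2) (by linarith : (s + t) / 2 ≤ s)
    linarith [hA.nonneg ht]

theorem aemeasurable_comp {v : EuclideanSpace ℝ (Fin N) → F} (hv : AEStronglyMeasurable v) (c : ℝ)
    {μ : Measure (EuclideanSpace ℝ (Fin N))} (hμ : μ ≪ volume) :
    AEMeasurable (fun x => ENNReal.ofReal (A (‖v x‖ / c))) μ := by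
  have h1 : AEMeasurable (fun x => ‖v x‖ / c) μ :=
    (hv.mono_ac hμ).norm.aemeasurable.div_const c
  exact (hA.continuous.measurable.comp_aemeasurable h1).ennreal_ofReal

theorem measure_norm_ge_le {v : EuclideanSpace ℝ (Fin N) → F} (hv : AEStronglyMeasurable v)
    {c ε : ℝ} (hc : 0 < c) (hε : 0 < ε) {μ : Measure (EuclideanSpace ℝ (Fin N))}
    (hμ : μ ≪ volume) :
    μ {x | ε ≤ ‖v x‖} ≤ (∫⁻ x, ENNReal.ofReal (A (‖v x‖ / c)) ∂μ) / ENNReal.ofReal (A (ε / c)) := by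
  have hp : 0 < A (ε / c) := hA.pos (by positivity)
  refine le_trans (measure_mono fun x hx => ?_)
    (meas_ge_le_lintegral_div (hA.aemeasurable_comp hv c hμ) (by simpa using hp)
      ENNReal.ofReal_ne_top)
  exact ENNReal.ofReal_le_ofReal (hA.mono (by positivity) (by gcongr; exact hx))

/-- Norm below c gives |{|v| ≥ ε}| ≤ 1/A(ε/c) by Chebyshev, and this tends to 0 with c. -/
theorem tendstoInMeasure_of_luxemburgNorm
    {φ : ℕ → EuclideanSpace ℝ (Fin N) → F} {u : EuclideanSpace ℝ (Fin N) → F}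
    (hφ : ∀ k, AEStronglyMeasurable (φ k)) (hu : AEStronglyMeasurable u)
    (h : Tendsto (fun k => luxemburgNorm A (fun x => φ k x - u x)) atTop (𝓝 0)) :
    TendstoInMeasure volume φ atTop u := by
  rw [tendstoInMeasure_iff_norm]
  intro ε hε
  refine ENNReal.tendsto_nhds_zero.2 fun δ hδ => ?_
  obtain ⟨c, hc0, hc⟩ : ∃ c : ℝ, 0 < c ∧ 1 / ENNReal.ofReal (A (ε / c)) ≤ δ := by
    have h1 : Tendsto (fun c : ℝ => A (ε / c)) (𝓝[>] 0) atTop :=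
      hA.tendsto.comp (tendsto_inv_nhdsGT_zero.const_mul_atTop hε)
    have h2 : Tendsto (fun c : ℝ => 1 / ENNReal.ofReal (A (ε / c))) (𝓝[>] 0) (𝓝 0) := by
      simp only [one_div]
      rw [tendsto_inv_iff.symm]
      simp only [inv_inv, ENNReal.inv_zero]
      exact ENNReal.tendsto_ofReal_atTop.comp h1
    obtain ⟨c, hc, hc0⟩ := ((ENNReal.tendsto_nhds_zero.1 h2 δ hδ).and self_mem_nhdsWithin).exists
    exact ⟨c, hc0, hc⟩
  filter_upwards [h.eventually (gt_mem_nhds (ENNReal.ofReal_pos.2 hc0))] with k hk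
  refine (hA.measure_norm_ge_le ((hφ k).sub hu) hc0 hε Measure.AbsolutelyContinuous.rfl).trans
    (le_trans ?_ hc)
  gcongr
  exact lintegral_le_one_of_luxemburgNorm_lt hA.monotoneOn hk

theorem lintegral_le_two {v w : EuclideanSpace ℝ (Fin N) → F} (hv : AEStronglyMeasurable v)
    (hw : AEStronglyMeasurable w) {c : ℝ} (hc : 0 < c)
    (h1 : luxemburgNorm A (fun x => v x - w x) < ENNReal.ofReal c)
    (h2 : luxemburgNorm A w < ENNReal.ofReal c) :
    ∫⁻ x, ENNReal.ofReal (A (‖v x‖ / (2 * c))) ≤ 2 := by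
  have := add_le_add (lintegral_le_one_of_luxemburgNorm_lt hA.monotoneOn h1)
    (lintegral_le_one_of_luxemburgNorm_lt hA.monotoneOn h2)
  have hmeas : AEMeasurable (fun x => ENNReal.ofReal (A (‖v x - w x‖ / c))) :=
    hA.aemeasurable_comp (hv.sub hw) c Measure.AbsolutelyContinuous.rfl
  rw [← lintegral_add_left' hmeas, one_add_one_eq_two] at this
  refine le_trans (lintegral_mono fun x => ?_) this
  rw [← ENNReal.ofReal_add (hA.nonneg' _) (hA.nonneg' _)]
  refine ENNReal.ofReal_le_ofReal (le_trans ?_ (hA.apply_mean_le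
    (div_nonneg (norm_nonneg _) hc.le) (div_nonneg (norm_nonneg _) hc.le)))
  refine hA.mono (by positivity) ?_
  have : ‖v x‖ ≤ ‖v x - w x‖ + ‖w x‖ := by
    simpa using norm_add_le (v x - w x) (w x)
  calc ‖v x‖ / (2 * c) ≤ (‖v x - w x‖ + ‖w x‖) / (2 * c) := by gcongr
    _ = _ := by field_simp

/-- Passing from 2c to 4c halves the modular, since A(2t) ≥ 2A(t). -/
theorem lintegral_le_one {v w : EuclideanSpace ℝ (Fin N) → F} (hl : 1 ≤ l)
    (hv : AEStronglyMeasurable v) (hw : AEStronglyMeasurable w) {c : ℝ} (hc : 0 < c)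
    (h1 : luxemburgNorm A (fun x => v x - w x) < ENNReal.ofReal c)
    (h2 : luxemburgNorm A w < ENNReal.ofReal c) :
    ∫⁻ x, ENNReal.ofReal (A (‖v x‖ / (4 * c))) ≤ 1 := by
  have h := hA.lintegral_le_two hv hw hc h1 h2
  have h3 : ∀ x, 2 * ENNReal.ofReal (A (‖v x‖ / (4 * c))) ≤
      ENNReal.ofReal (A (‖v x‖ / (2 * c))) := fun x => by
    rw [← ENNReal.ofReal_ofNat, ← ENNReal.ofReal_mul zero_le_two]
    refine ENNReal.ofReal_le_ofReal ((hA.mul_le hl one_le_two (by positivity)).trans_eq ?_)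
    congr 1; field_simp; ring
  have h4 := (lintegral_mono h3).trans h
  rw [lintegral_const_mul' _ _ (by simp)] at h4
  exact (ENNReal.mul_le_mul_iff_right two_ne_zero (by simp)).1 (h4.trans_eq (mul_one _).symm)

end IsGrowth

end Modular

/-! ### The Orlicz–Sobolev inequality -/

theorem norm_gradient {N : ℕ} (φ : EuclideanSpace ℝ (Fin N) → ℝ) (x : EuclideanSpace ℝ (Fin N)) :
    ‖gradient φ x‖ = ‖fderiv ℝ φ x‖ := by
  simp [gradient]

theorem continuous_gradient {N : ℕ} {φ : EuclideanSpace ℝ (Fin N) → ℝ} (hφ : ContDiff ℝ ∞ φ) :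
    Continuous (gradient φ) :=
  (InnerProductSpace.toDual ℝ (EuclideanSpace ℝ (Fin N))).symm.continuous.comp
    (hφ.continuous_fderiv (by simp))

namespace IsGrowth

variable {A : ℝ → ℝ} {l m : ℝ} (hA : IsGrowth A l m)
include hA

/-- The Gagliardo–Nirenberg–Sobolev inequality applied to `(A_* (σ φ)) ^ (1 - 1 / N)`. -/
theorem lintegral_sobolevConjugate_le {N : ℕ} (hl : 1 < l) (hm : 1 < m) (hmN : m < N)
    {φ : EuclideanSpace ℝ (Fin N) → ℝ} (hφ : ContDiff ℝ 1 φ) (hφc : HasCompactSupport φ)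
    {p : ℝ} (hp : (N : ℝ).HolderConjugate p) {η σ : ℝ} (hη : 0 < η) (hσ : 0 ≤ σ) :
    ∫⁻ x, ENNReal.ofReal (sobolevConjugate N A (σ * φ x)) ≤
      lintegralPowLePowLIntegralFDerivConst (volume : Measure (EuclideanSpace ℝ (Fin N))) p *
      (ENNReal.ofReal η * ((∫⁻ x, ENNReal.ofReal (sobolevConjugate N A (σ * φ x))) +
        ∫⁻ x, ENNReal.ofReal (A (σ * ‖fderiv ℝ φ x‖ / η)))) ^ p := by
  set h : ℝ → ℝ := fun t => sobolevConjugate N A t ^ (1 - (N : ℝ)⁻¹) with hh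
  have hS0 := hA.sobolevConjugate_zero (N := N) hl.le hm hmN
  have hSn := hA.sobolevConjugate_nonneg (N := N) hl.le hm hmN
  have hp' : 1 - (N : ℝ)⁻¹ = p⁻¹ := hp.one_sub_inv
  have hC : ContDiff ℝ 1 h := hA.contDiff_sobolevConjugate_rpow hl hm hmN
  have hh0 : h 0 = 0 := by
    simp only [hh, hS0, hp']
    exact Real.zero_rpow (inv_ne_zero hp.symm.ne_zero)
  have hf : ContDiff ℝ 1 (fun x => h (σ * φ x)) := hC.comp (contDiff_const.mul hφ)
  have hfc : HasCompactSupport (fun x => h (σ * φ x)) :=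
    hφc.comp_left (g := fun t => h (σ * t)) (by simp [hh0])
  have key := lintegral_pow_le_pow_lintegral_fderiv volume hf hfc (p := p) (by simpa using hp)
  have hl1 : ∀ x, ‖h (σ * φ x)‖ₑ ^ p = ENNReal.ofReal (sobolevConjugate N A (σ * φ x)) := by
    intro x
    rw [Real.enorm_of_nonneg (Real.rpow_nonneg (hSn _) _),
      ENNReal.ofReal_rpow_of_nonneg (Real.rpow_nonneg (hSn _) _) hp.symm.nonneg, hp']
    congr 1
    exact Real.rpow_inv_rpow (hSn _) hp.symm.ne_zero
  simp only [hl1] at key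
  refine key.trans ?_
  gcongr
  · exact hp.symm.nonneg
  rw [← lintegral_add_left, ← lintegral_const_mul']
  · refine lintegral_mono fun x => ?_
    rw [← ENNReal.ofReal_add (hSn _) (hA.nonneg' _), ← ENNReal.ofReal_mul hη.le,
      ← ofReal_norm]
    refine ENNReal.ofReal_le_ofReal ?_
    have hφd : HasFDerivAt φ (fderiv ℝ φ x) x := (hφ.differentiable one_ne_zero x).hasFDerivAt
    have hd : HasDerivAt h (deriv h (σ * φ x)) (σ * φ x) :=
      (hC.differentiable one_ne_zero _).hasDerivAt
    have := hd.comp_hasFDerivAt x (hφd.const_mul σ)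
    have hfd : fderiv ℝ (fun x => h (σ * φ x)) x = _ := this.fderiv
    rw [hfd, norm_smul, norm_smul, Real.norm_of_nonneg hσ, Real.norm_eq_abs]
    refine le_trans ?_ (hA.div_inv_mul_le hl.le (hSn (σ * φ x)) (ρ := σ * ‖fderiv ℝ φ x‖) hη)
    gcongr
    exact hA.abs_deriv_sobolevConjugate_rpow_le hl hm hmN _
  · exact ENNReal.ofReal_ne_top
  · exact ((hA.continuous_sobolevConjugate hl.le hm hmN).comp
      (continuous_const.mul hφ.continuous)).measurable.ennreal_ofReal

/-- Let X(σ) be the A_*-modular of σφ. The previous estimate reads X ≤ C(η(X + Y))^p with Y ≤ 1, and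
for small η it excludes X = 1. As X is continuous with X(0) = 0, it never exceeds 1. -/
theorem exists_sobolev_const {N : ℕ} (hl : 1 < l) (hm : 1 < m) (hmN : m < N) :
    ∃ η : ℝ, 0 < η ∧ ∀ φ : EuclideanSpace ℝ (Fin N) → ℝ, ContDiff ℝ 1 φ → HasCompactSupport φ →
      ∀ σ : ℝ, 0 < σ → ∫⁻ x, ENNReal.ofReal (A (σ * ‖fderiv ℝ φ x‖ / η)) ≤ 1 →
        ∫⁻ x, ENNReal.ofReal (sobolevConjugate N A (σ * φ x)) ≤ 1 := by
  have hp : (N : ℝ).HolderConjugate (N : ℝ).conjExponent :=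
    Real.HolderConjugate.conjExponent (hm.trans hmN)
  set p := (N : ℝ).conjExponent
  set C : ℝ≥0 := lintegralPowLePowLIntegralFDerivConst
    (volume : Measure (EuclideanSpace ℝ (Fin N))) p with hC
  have hp0 : 0 < p := hp.symm.pos
  obtain ⟨η, hη, hηC⟩ : ∃ η : ℝ, 0 < η ∧ C * (ENNReal.ofReal η * 2) ^ p < 1 := by
    -- This η makes C(2η)^p equal to C/(C + 1).
    refine ⟨(((C : ℝ) + 1)⁻¹) ^ p⁻¹ / 2, by positivity, ?_⟩
    rw [← ENNReal.ofReal_ofNat, ← ENNReal.ofReal_mul (by positivity),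
      div_mul_cancel₀ _ two_ne_zero,
      ENNReal.ofReal_rpow_of_nonneg (by positivity) hp0.le,
      Real.rpow_inv_rpow (by positivity) hp0.ne', ← ENNReal.ofReal_coe_nnreal,
      ← ENNReal.ofReal_mul C.coe_nonneg, ENNReal.ofReal_lt_one, ← div_eq_mul_inv,
      div_lt_one (by positivity)]
    linarith
  refine ⟨η, hη, fun φ hφ hφc σ₀ hσ₀ hY => ?_⟩
  have hSc := hA.continuous_sobolevConjugate (N := N) hl.le hm hmN
  have hSn := hA.sobolevConjugate_nonneg (N := N) hl.le hm hmN
  have hS0 := hA.sobolevConjugate_zero (N := N) hl.le hm hmN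
  by_contra! hX
  set X : ℝ → ℝ := fun σ => ∫ x in tsupport φ, sobolevConjugate N A (σ * φ x) with hXdef
  have hXX : ∀ σ, ∫⁻ x, ENNReal.ofReal (sobolevConjugate N A (σ * φ x)) =
      ENNReal.ofReal (X σ) := by
    intro σ
    have hcont : Continuous fun x => sobolevConjugate N A (σ * φ x) :=
      hSc.comp (continuous_const.mul hφ.continuous)
    have hcs : HasCompactSupport fun x => sobolevConjugate N A (σ * φ x) :=
      hφc.comp_left (g := fun t => sobolevConjugate N A (σ * t)) (by simp [hS0])
    rw [hXdef]
    beta_reduce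
    rw [setIntegral_eq_integral_of_forall_compl_eq_zero]
    · exact (ofReal_integral_eq_lintegral_ofReal (hcont.integrable_of_hasCompactSupport hcs)
        (Eventually.of_forall fun x => hSn _)).symm
    · intro x hx
      rw [image_eq_zero_of_notMem_tsupport hx, mul_zero, hS0]
  have hXc : Continuous X := by
    refine continuous_parametric_integral_of_continuous
      (f := fun σ x => sobolevConjugate N A (σ * φ x)) ?_ hφc
    exact hSc.comp (continuous_fst.mul (hφ.continuous.comp continuous_snd))
  have hX0 : X 0 = 0 := by simp [hXdef, hS0]
  have hX1 : 1 ≤ X σ₀ := by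
    rw [hXX, ENNReal.one_lt_ofReal] at hX
    exact hX.le
  obtain ⟨σ, hσ, hσ1⟩ := intermediate_value_Icc hσ₀.le hXc.continuousOn
    (show (1 : ℝ) ∈ Icc (X 0) (X σ₀) from ⟨by rw [hX0]; exact zero_le_one, hX1⟩)
  have hYσ : ∫⁻ x, ENNReal.ofReal (A (σ * ‖fderiv ℝ φ x‖ / η)) ≤ 1 := by
    refine le_trans (lintegral_mono fun x => ENNReal.ofReal_le_ofReal ?_) hY
    have := hσ.1
    refine hA.mono (by positivity) ?_
    gcongr
    exact hσ.2
  have := hA.lintegral_sobolevConjugate_le hl hm hmN hφ hφc hp hη hσ.1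
  rw [hXX, hσ1, ENNReal.ofReal_one] at this
  refine absurd (this.trans ?_) hηC.not_ge
  have h2 := (add_le_add_right hYσ 1).trans_eq one_add_one_eq_two
  gcongr

/-- The Orlicz–Sobolev inequality of Donaldson and Trudinger, in modular form. -/
theorem exists_memOrliczSobolev_const {N : ℕ} (hl : 1 < l) (hm : 1 < m) (hmN : m < N) :
    ∃ η : ℝ, 0 < η ∧ ∀ (u : EuclideanSpace ℝ (Fin N) → ℝ)
      (G : EuclideanSpace ℝ (Fin N) → EuclideanSpace ℝ (Fin N)), MemOrliczSobolev A u G →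
      ∀ c : ℝ, 0 < c → luxemburgNorm A G < ENNReal.ofReal c →
        ∫⁻ x, ENNReal.ofReal (sobolevConjugate N A (η / c * u x)) ≤ 1 := by
  obtain ⟨η, hη, H⟩ := hA.exists_sobolev_const (N := N) hl hm hmN
  refine ⟨η / 4, by positivity, fun u G hu c hc hGc => ?_⟩
  obtain ⟨hum, hGm, φ, hφ, hφu, hφG⟩ := hu
  have hSc := hA.continuous_sobolevConjugate (N := N) hl.le hm hmN
  have hbound : ∀ᶠ k in atTop,
      ∫⁻ x, ENNReal.ofReal (sobolevConjugate N A (η / 4 / c * φ k x)) ≤ 1 := by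
    filter_upwards [hφG.eventually (gt_mem_nhds (ENNReal.ofReal_pos.2 hc))] with k hk
    refine H (φ k) ((hφ k).1.of_le (by simp)) (hφ k).2 _ (by positivity) ?_
    have := hA.lintegral_le_one hl.le (continuous_gradient (hφ k).1).aestronglyMeasurable hGm hc
      hk hGc
    refine le_trans (lintegral_mono fun x => le_of_eq ?_) this
    rw [norm_gradient]
    congr 2
    field_simp
  -- An a.e. convergent subsequence of test functions allows Fatou's lemma.
  obtain ⟨ns, hns, hae⟩ := (hA.tendstoInMeasure_of_luxemburgNorm
    (fun k => (hφ k).1.continuous.aestronglyMeasurable) hum hφu).exists_seq_tendsto_ae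
  have hcomp : Continuous fun t => ENNReal.ofReal (sobolevConjugate N A (η / 4 / c * t)) :=
    ENNReal.continuous_ofReal.comp (hSc.comp (continuous_const.mul continuous_id))
  calc ∫⁻ x, ENNReal.ofReal (sobolevConjugate N A (η / 4 / c * u x))
      = ∫⁻ x, liminf (fun k =>
          ENNReal.ofReal (sobolevConjugate N A (η / 4 / c * φ (ns k) x))) atTop := by
        refine lintegral_congr_ae (hae.mono fun x hx => ?_)
        exact (((hcomp.tendsto (u x)).comp hx).liminf_eq).symm
    _ ≤ liminf (fun k => ∫⁻ x,
          ENNReal.ofReal (sobolevConjugate N A (η / 4 / c * φ (ns k) x))) atTop :=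
        lintegral_liminf_le fun k => (hcomp.comp (hφ (ns k)).1.continuous).measurable
    _ ≤ 1 := liminf_le_of_frequently_le' (hns.tendsto_atTop.eventually hbound).frequently

end IsGrowth

/-! ### A Sobolev inequality averaged over translations -/

section Averaging

variable {N : ℕ}

theorem measurable_lintegral_translate_mul {f g : EuclideanSpace ℝ (Fin N) → ℝ≥0∞}
    (hf : Measurable f) (hg : Measurable g) :
    Measurable fun y => ∫⁻ x, f (x - y) * g x :=
  Measurable.lintegral_prod_right' (f := fun z : EuclideanSpace ℝ (Fin N) ×
    EuclideanSpace ℝ (Fin N) => f (z.2 - z.1) * g z.2)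
    ((hf.comp (measurable_snd.sub measurable_fst)).mul (hg.comp measurable_snd))

theorem lintegral_lintegral_translate_mul {f g : EuclideanSpace ℝ (Fin N) → ℝ≥0∞}
    (hf : Measurable f) (hg : Measurable g) :
    ∫⁻ y, ∫⁻ x, f (x - y) * g x = (∫⁻ x, f x) * ∫⁻ x, g x := by
  rw [lintegral_lintegral_swap]
  · have : ∀ x, ∫⁻ y, f (x - y) * g x = (∫⁻ x, f x) * g x := fun x => by
      have hm : Measurable fun y => f (x - y) := hf.comp (measurable_id.const_sub x)
      rw [lintegral_mul_const _ hm,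
        lintegral_sub_left_eq_self]
    simp only [this]
    rw [lintegral_const_mul _ hg]
  · exact ((hf.comp (measurable_snd.sub measurable_fst)).mul
      (hg.comp measurable_snd)).aemeasurable

/-- Hölder's inequality and the Gagliardo–Nirenberg–Sobolev inequality, for a function whose
support has small measure. -/
theorem lintegral_enorm_le_measure_rpow_mul {p : ℝ} (hp : (N : ℝ).HolderConjugate p)
    {f : EuclideanSpace ℝ (Fin N) → ℝ} (hf : ContDiff ℝ 1 f) (hfc : HasCompactSupport f)
    {T : Set (EuclideanSpace ℝ (Fin N))} (hT : MeasurableSet T) (hfT : ∀ x ∉ T, f x = 0) :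
    ∫⁻ x, ‖f x‖ₑ ≤
      (lintegralPowLePowLIntegralFDerivConst (volume : Measure (EuclideanSpace ℝ (Fin N))) p :
        ℝ≥0∞) ^ p⁻¹ * volume T ^ (N : ℝ)⁻¹ * ∫⁻ x, ‖fderiv ℝ f x‖ₑ := by
  have hp0 : 0 < p := hp.symm.pos
  have hN0 : (0 : ℝ) < N := hp.pos
  have key := lintegral_pow_le_pow_lintegral_fderiv volume hf hfc (p := p) (by simpa using hp)
  have hH := ENNReal.lintegral_mul_le_Lp_mul_Lq volume hp.symm
    (f := fun x => ‖f x‖ₑ) (g := T.indicator 1)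
    hf.continuous.enorm.measurable.aemeasurable (measurable_one.indicator hT).aemeasurable
  have h1 : ∀ x, ((fun x => ‖f x‖ₑ) * T.indicator (1 : EuclideanSpace ℝ (Fin N) → ℝ≥0∞)) x = ‖f x‖ₑ := fun x => by
    by_cases hx : x ∈ T
    · simp [hx]
    · simp [hx, hfT x hx]
  have h2 : ∀ x, (T.indicator (1 : EuclideanSpace ℝ (Fin N) → ℝ≥0∞) x) ^ (N : ℝ) =
      T.indicator (1 : EuclideanSpace ℝ (Fin N) → ℝ≥0∞) x := fun x => by
    by_cases hx : x ∈ T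
    · simp [hx]
    · simp [hx, Nat.cast_pos.1 hN0 |>.ne']
  simp only [h1, h2] at hH
  rw [lintegral_indicator_one hT, one_div, one_div] at hH
  refine hH.trans ?_
  have h3 := ENNReal.rpow_le_rpow key (inv_pos.2 hp0).le
  rw [ENNReal.mul_rpow_of_nonneg _ _ (inv_pos.2 hp0).le, ENNReal.rpow_rpow_inv hp0.ne'] at h3
  refine (mul_le_mul_left h3 _).trans_eq ?_
  ring

/-- Localise w by b(· − y), supported in a ball of radius R, apply the small-support inequality, and
integrate in y. By Tonelli each convolution integral factors, and dividing by J = ∫|b| gives K = C(1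
+ J'/J) with J' = ∫|∇b|. -/
theorem exists_averaged_sobolev_const (hN : 1 < (N : ℝ)) {R : ℝ} (hR : 0 < R) :
    ∃ K : ℝ≥0∞, K ≠ ⊤ ∧ ∀ w : EuclideanSpace ℝ (Fin N) → ℝ, ContDiff ℝ 1 w →
      HasCompactSupport w → ∀ μ : ℝ≥0∞,
      (∀ y, volume ({x | w x ≠ 0} ∩ Metric.ball y R) ≤ μ) →
      ∫⁻ x, ‖w x‖ₑ ≤ K * μ ^ (N : ℝ)⁻¹ * ((∫⁻ x, ‖fderiv ℝ w x‖ₑ) + ∫⁻ x, ‖w x‖ₑ) := by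
  have hp : (N : ℝ).HolderConjugate (N : ℝ).conjExponent := Real.HolderConjugate.conjExponent hN
  set p := (N : ℝ).conjExponent
  have hp0 : 0 < p := hp.symm.pos
  set C : ℝ≥0∞ := (lintegralPowLePowLIntegralFDerivConst
    (volume : Measure (EuclideanSpace ℝ (Fin N))) p : ℝ≥0∞) ^ p⁻¹ with hC
  have hCtop : C ≠ ⊤ := ENNReal.rpow_ne_top_of_nonneg (inv_pos.2 hp0).le ENNReal.coe_ne_top
  let b : ContDiffBump (0 : EuclideanSpace ℝ (Fin N)) := ⟨R / 2, R, by positivity, by linarith⟩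
  have hb : ContDiff ℝ 1 b := b.contDiff
  have hbd : Continuous (fderiv ℝ b) := hb.continuous_fderiv one_ne_zero
  set J : ℝ≥0∞ := ∫⁻ x, ‖b x‖ₑ with hJ
  set J' : ℝ≥0∞ := ∫⁻ x, ‖fderiv ℝ b x‖ₑ with hJ'
  have hJtop : J ≠ ⊤ :=
    (hb.continuous.integrable_of_hasCompactSupport b.hasCompactSupport).hasFiniteIntegral.ne
  have hJ'top : J' ≠ ⊤ :=
    (hbd.integrable_of_hasCompactSupport (b.hasCompactSupport.fderiv ℝ)).hasFiniteIntegral.ne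
  have hJ0 : J ≠ 0 := by
    have h1 : volume (Metric.ball (0 : EuclideanSpace ℝ (Fin N)) (R / 2)) ≤ J := by
      rw [← setLIntegral_one]
      refine le_trans (setLIntegral_mono' measurableSet_ball fun x hx => ?_)
        (setLIntegral_le_lintegral _ _)
      rw [b.one_of_mem_closedBall (Metric.ball_subset_closedBall hx)]
      simp
    exact (lt_of_lt_of_le (Metric.measure_ball_pos volume _ (by positivity)) h1).ne'
  refine ⟨C * (1 + J' / J), ENNReal.mul_ne_top hCtop (by finiteness), ?_⟩
  intro w hw hwc μ hμ
  have hwd : Continuous (fderiv ℝ w) := hw.continuous_fderiv one_ne_zero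
  have hloc : ∀ y, ∫⁻ x, ‖b (x - y)‖ₑ * ‖w x‖ₑ ≤ C * μ ^ (N : ℝ)⁻¹ *
      ((∫⁻ x, ‖b (x - y)‖ₑ * ‖fderiv ℝ w x‖ₑ) + ∫⁻ x, ‖fderiv ℝ b (x - y)‖ₑ * ‖w x‖ₑ) := by
    intro y
    have hby : ContDiff ℝ 1 fun x => b (x - y) := hb.comp (contDiff_id.sub contDiff_const)
    have hT : MeasurableSet ({x | w x ≠ 0} ∩ Metric.ball y R) :=
      (isOpen_ne_fun hw.continuous continuous_const).measurableSet.inter measurableSet_ball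
    have := lintegral_enorm_le_measure_rpow_mul hp (hby.mul hw) (hwc.mul_left) hT ?_
    · simp only [enorm_mul] at this
      refine this.trans ?_
      gcongr
      · exact hμ y
      have hm : Measurable fun x => ‖b (x - y)‖ₑ * ‖fderiv ℝ w x‖ₑ :=
        hby.continuous.enorm.measurable.mul hwd.enorm.measurable
      rw [← lintegral_add_left hm]
      refine lintegral_mono fun x => ?_
      have hd := fderiv_fun_mul (hby.differentiable one_ne_zero x) (hw.differentiable one_ne_zero x)
      rw [hd, fderiv_comp_sub]
      refine (enorm_add_le (b (x - y) • fderiv ℝ w x) (w x • fderiv ℝ b (x - y))).trans ?_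
      rw [enorm_smul, enorm_smul, mul_comm ‖w x‖ₑ]
    · intro x hx
      by_cases hwx : w x = 0
      · simp [hwx]
      · have hxy : x ∉ Metric.ball y R := fun h => hx ⟨hwx, h⟩
        have : b (x - y) = 0 := b.zero_of_le_dist (by
          simpa [dist_eq_norm] using hxy)
        simp [this]
  have hint := lintegral_mono (μ := volume) hloc
  have hmb := hb.continuous.enorm.measurable
  have hmbd := hbd.enorm.measurable
  have hmw := hw.continuous.enorm.measurable
  have hmwd := hwd.enorm.measurable
  have hms : Measurable fun y => (∫⁻ x, ‖b (x - y)‖ₑ * ‖fderiv ℝ w x‖ₑ) +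
      ∫⁻ x, ‖fderiv ℝ b (x - y)‖ₑ * ‖w x‖ₑ :=
    (measurable_lintegral_translate_mul hmb hmwd).add (measurable_lintegral_translate_mul hmbd hmw)
  rw [lintegral_lintegral_translate_mul hmb hmw,
    lintegral_const_mul _ hms, lintegral_add_left (measurable_lintegral_translate_mul hmb hmwd),
    lintegral_lintegral_translate_mul hmb hmwd,
    lintegral_lintegral_translate_mul hmbd hmw, ← hJ, ← hJ'] at hint
  refine (ENNReal.mul_le_mul_iff_right hJ0 hJtop).1 (hint.trans ?_)
  have hJJ : J * (1 + J' / J) = J + J' := by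
    rw [mul_add, mul_one, ENNReal.mul_div_cancel hJ0 hJtop]
  calc _ ≤ C * μ ^ (N : ℝ)⁻¹ * ((J + J') * ((∫⁻ x, ‖fderiv ℝ w x‖ₑ) + ∫⁻ x, ‖w x‖ₑ)) := by
        gcongr
        rw [mul_add]
        gcongr
        · exact le_self_add
        · exact le_add_self
    _ = _ := by rw [← hJJ]; ring

end Averaging

/-! ### Superlevel sets of vanishing sequences -/

theorem exists_cutoff {δ : ℝ} (hδ : 0 < δ) :
    ∃ (τ : ℝ → ℝ) (L : ℝ), 0 ≤ L ∧ ContDiff ℝ 1 τ ∧ (∀ t, 0 ≤ τ t) ∧ (∀ t, τ t ≤ 1) ∧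
      (∀ t, |t| ≤ δ → τ t = 0) ∧ (∀ t, 2 * δ ≤ |t| → τ t = 1) ∧ (∀ t, |deriv τ t| ≤ L) ∧
      ∀ t, |t| ≤ δ → deriv τ t = 0 := by
  let b : ContDiffBump (0 : ℝ) := ⟨δ, 2 * δ, hδ, by linarith⟩
  have hb : ContDiff ℝ 1 b := b.contDiff
  have hd : deriv (fun t => 1 - b t) = fun t => -deriv b t := funext fun t => by simp
  obtain ⟨L, hL⟩ := (hb.continuous_deriv le_rfl).bounded_above_of_compact_support
    b.hasCompactSupport.deriv
  have h0 : ∀ t, |t| ≤ δ → 1 - b t = 0 := fun t ht => by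
    rw [b.one_of_mem_closedBall (by simpa using ht), sub_self]
  refine ⟨fun t => 1 - b t, L, (norm_nonneg _).trans (hL 0), contDiff_const.sub hb,
    fun t => sub_nonneg.2 b.le_one, fun t => by linarith [b.nonneg' t], h0, fun t ht => ?_,
    fun t => ?_, fun t ht => ?_⟩
  · beta_reduce
    rw [b.zero_of_le_dist (by simpa using ht), sub_zero]
  · rw [hd, abs_neg]
    exact hL t
  · refine IsLocalMin.deriv_eq_zero (Eventually.of_forall fun s => ?_)
    beta_reduce
    rw [h0 t ht]
    exact sub_nonneg.2 b.le_one

namespace IsGrowth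

variable {A : ℝ → ℝ} {l m : ℝ} (hA : IsGrowth A l m)
include hA

/-- The averaged inequality is applied to τ(φ), which is 1 where |φ| ≥ 2δ and 0 where |φ| ≤ δ. Where
|φ| ≥ δ, 1 ≤ A(|φ|)/A(δ), so both τ(φ) and its gradient are controlled by A-modulars. -/
theorem exists_superlevel_const {N : ℕ} (hl : 1 ≤ l) (hN : 1 < (N : ℝ)) {R δ : ℝ} (hR : 0 < R)
    (hδ : 0 < δ) :
    ∃ K : ℝ≥0∞, K ≠ ⊤ ∧ ∀ φ : EuclideanSpace ℝ (Fin N) → ℝ, ContDiff ℝ 1 φ →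
      HasCompactSupport φ → ∀ μ : ℝ≥0∞,
      (∀ y, volume ({x | δ ≤ ‖φ x‖} ∩ Metric.ball y R) ≤ μ) →
      volume {x | 2 * δ ≤ ‖φ x‖} ≤ K * μ ^ (N : ℝ)⁻¹ *
        ((∫⁻ x, ENNReal.ofReal (A ‖φ x‖)) + ∫⁻ x, ENNReal.ofReal (A ‖fderiv ℝ φ x‖)) := by
  obtain ⟨K, hK, H⟩ := exists_averaged_sobolev_const hN hR
  obtain ⟨τ, L, hL, hτ, hτ0, hτ1, hτδ, hτ2, hτL, hτd⟩ := exists_cutoff hδ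
  have hAδ := hA.pos hδ
  have hA1 := hA.pos one_pos
  set c : ℝ := (L + 1) / A δ + L / A 1 with hc
  have hc0 : 0 ≤ c := by positivity
  refine ⟨K * ENNReal.ofReal c, ENNReal.mul_ne_top hK ENNReal.ofReal_ne_top,
    fun φ hφ hφc μ hμ => ?_⟩
  have hw : ContDiff ℝ 1 (fun x => τ (φ x)) := hτ.comp hφ
  have hwc : HasCompactSupport (fun x => τ (φ x)) := hφc.comp_left (hτδ 0 (by simpa using hδ.le))
  have hne : ∀ x, τ (φ x) ≠ 0 → δ ≤ ‖φ x‖ := fun x hx => by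
    by_contra! h
    exact hx (hτδ _ h.le)
  have h1 : volume {x | 2 * δ ≤ ‖φ x‖} ≤ ∫⁻ x, ‖τ (φ x)‖ₑ := by
    rw [← setLIntegral_one]
    refine le_trans (setLIntegral_mono' ?_ fun x hx => ?_) (setLIntegral_le_lintegral _ _)
    · exact (isClosed_le continuous_const hφ.continuous.norm).measurableSet
    · rw [hτ2 _ hx, enorm_one]
  refine h1.trans ((H _ hw hwc μ fun y =>
    (measure_mono (inter_subset_inter_left _ hne)).trans (hμ y)).trans ?_)
  rw [mul_assoc, mul_assoc, mul_assoc, mul_left_comm (ENNReal.ofReal c)]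
  gcongr
  have hmφ : Measurable fun x => ENNReal.ofReal (A ‖φ x‖) :=
    (hA.continuous.comp hφ.continuous.norm).measurable.ennreal_ofReal
  rw [← lintegral_add_left hmφ, ← lintegral_const_mul' _ _ ENNReal.ofReal_ne_top,
    ← lintegral_add_left (hw.continuous_fderiv one_ne_zero).enorm.measurable]
  refine lintegral_mono fun x => ?_
  rw [← ENNReal.ofReal_add (hA.nonneg' _) (hA.nonneg' _), ← ENNReal.ofReal_mul hc0,
    ← ofReal_norm, ← ofReal_norm, ← ENNReal.ofReal_add (norm_nonneg _) (norm_nonneg _)]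
  refine ENNReal.ofReal_le_ofReal ?_
  have hd : HasDerivAt τ (deriv τ (φ x)) (φ x) := (hτ.differentiable one_ne_zero _).hasDerivAt
  have hfd : fderiv ℝ (fun x => τ (φ x)) x = _ :=
    (hd.comp_hasFDerivAt x (hφ.differentiable one_ne_zero x).hasFDerivAt).fderiv
  rw [hfd, norm_smul, Real.norm_of_nonneg (hτ0 _), Real.norm_eq_abs]
  have hn1 := hA.nonneg' ‖φ x‖
  have hn2 := hA.nonneg' ‖fderiv ℝ φ x‖
  rcases le_total ‖φ x‖ δ with h | h
  · rw [hτd _ h, hτδ _ h, abs_zero, zero_mul, add_zero]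
    positivity
  · have hφ1 : 1 ≤ A ‖φ x‖ / A δ := (one_le_div hAδ).2 (hA.mono hδ.le h)
    have hg : ‖fderiv ℝ φ x‖ ≤ A ‖φ x‖ / A δ + A ‖fderiv ℝ φ x‖ / A 1 := by
      rcases le_total ‖fderiv ℝ φ x‖ 1 with h' | h'
      · have : 0 ≤ A ‖fderiv ℝ φ x‖ / A 1 := by positivity
        linarith
      · have := hA.mul_le hl h' zero_le_one
        rw [mul_one, ← le_div_iff₀ hA1] at this
        linarith
    calc |deriv τ (φ x)| * ‖fderiv ℝ φ x‖ + τ (φ x)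
        ≤ L * (A ‖φ x‖ / A δ + A ‖fderiv ℝ φ x‖ / A 1) + A ‖φ x‖ / A δ := by
          gcongr
          · exact hτL _
          · exact (hτ1 _).trans hφ1
      _ = (L + 1) / A δ * A ‖φ x‖ + L / A 1 * A ‖fderiv ℝ φ x‖ := by ring
      _ ≤ c * A ‖φ x‖ + c * A ‖fderiv ℝ φ x‖ := by
          gcongr
          · rw [hc]; linarith [show 0 ≤ L / A 1 by positivity]
          · rw [hc]; linarith [show 0 ≤ (L + 1) / A δ by positivity]
      _ = _ := by ring

theorem apply_add_le {s t : ℝ} (hs : 0 ≤ s) (ht : 0 ≤ t) :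
    A (s + t) ≤ 2 ^ m * (A s + A t) := by
  have := hA.upper 2 ((s + t) / 2) one_le_two (by positivity)
  rw [mul_div_cancel₀ _ two_ne_zero] at this
  exact this.trans (by gcongr; exact hA.apply_mean_le hs ht)

section

variable {N : ℕ} {F : Type*} [NormedAddCommGroup F]

theorem lintegral_le_rpow_mul {v : EuclideanSpace ℝ (Fin N) → F} {c : ℝ} (hc : 1 ≤ c) {b : ℝ≥0∞}
    (h : ∫⁻ x, ENNReal.ofReal (A (‖v x‖ / c)) ≤ b) :
    ∫⁻ x, ENNReal.ofReal (A ‖v x‖) ≤ ENNReal.ofReal (c ^ m) * b := by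
  refine le_trans ?_ (mul_le_mul_right h _)
  rw [← lintegral_const_mul' _ _ ENNReal.ofReal_ne_top]
  refine lintegral_mono fun x => ?_
  have hc0 : 0 < c := by linarith
  rw [← ENNReal.ofReal_mul (by positivity)]
  refine ENNReal.ofReal_le_ofReal ?_
  have := hA.upper c (‖v x‖ / c) hc (by positivity)
  rwa [mul_div_cancel₀ _ hc0.ne'] at this

theorem lintegral_le_of_luxemburgNorm_lt (hl : 1 ≤ l) {v : EuclideanSpace ℝ (Fin N) → F} {c : ℝ}
    (hc0 : 0 < c) (hc : c ≤ 1) (h : luxemburgNorm A v < ENNReal.ofReal c) :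
    ∫⁻ x, ENNReal.ofReal (A ‖v x‖) ≤ ENNReal.ofReal c := by
  have h1 := mul_le_mul_right (lintegral_le_one_of_luxemburgNorm_lt hA.monotoneOn h)
    (ENNReal.ofReal c)
  rw [mul_one, ← lintegral_const_mul' _ _ ENNReal.ofReal_ne_top] at h1
  refine le_trans (lintegral_mono fun x => ?_) h1
  rw [← ENNReal.ofReal_mul hc0.le]
  refine ENNReal.ofReal_le_ofReal ?_
  have := hA.mul_le hl ((one_le_inv₀ hc0).2 hc) (norm_nonneg (v x))
  rw [inv_mul_le_iff₀ hc0] at this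
  rwa [div_eq_inv_mul]

/-- Vanishing in the sense of Lions forces the superlevel sets to have vanishing measure. -/
theorem tendsto_measure_superlevel (hl : 1 ≤ l) (hN : 1 < (N : ℝ))
    {u : ℕ → EuclideanSpace ℝ (Fin N) → ℝ}
    {G : ℕ → EuclideanSpace ℝ (Fin N) → EuclideanSpace ℝ (Fin N)}
    (hu : ∀ n, MemOrliczSobolev A (u n) (G n)) {c : ℝ} (hc : 1 ≤ c)
    (huc : ∀ n, luxemburgNorm A (u n) < ENNReal.ofReal c)
    (hGc : ∀ n, luxemburgNorm A (G n) < ENNReal.ofReal c) {R : ℝ} (hR : 0 < R)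
    (hv : Tendsto (fun n => ⨆ y, modularOn A (Metric.ball y R) (u n)) atTop (𝓝 0))
    {δ : ℝ} (hδ : 0 < δ) :
    Tendsto (fun n => volume {x | 3 * δ ≤ ‖u n x‖}) atTop (𝓝 0) := by
  obtain ⟨K, hK, H⟩ := hA.exists_superlevel_const hl hN hR hδ
  set V : ℕ → ℝ≥0∞ := fun n => ⨆ y, modularOn A (Metric.ball y R) (u n)
  -- Each u_n is replaced by a test function within α_n in norm, for u_n and its gradient alike; the
  -- error disappears in the limit.
  set α : ℕ → ℝ := fun n => 1 / ((n : ℝ) + 1) with hα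
  have hα0 : ∀ n, 0 < α n := fun n => by positivity
  have hα1 : ∀ n, α n ≤ 1 := fun n => by
    rw [hα, div_le_one (by positivity)]; linarith [(Nat.cast_nonneg n : (0 : ℝ) ≤ n)]
  have hc0 : 0 < c := by linarith
  set M : ℝ≥0∞ := ENNReal.ofReal ((2 * c) ^ m) * 2 with hM
  set Q : ℝ≥0∞ := ENNReal.ofReal (2 ^ m) / ENNReal.ofReal (A δ) with hQ
  have hAδ : ENNReal.ofReal (A δ) ≠ 0 := by simpa using hA.pos hδ
  have hQtop : Q ≠ ⊤ := ENNReal.div_ne_top ENNReal.ofReal_ne_top hAδ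
  have hαlim : Tendsto (fun n => ENNReal.ofReal (α n)) atTop (𝓝 0) := by
    rw [← ENNReal.ofReal_zero]
    exact (ENNReal.continuous_ofReal.tendsto 0).comp tendsto_one_div_add_atTop_nhds_zero_nat
  have hbound : ∀ n, volume {x | 3 * δ ≤ ‖u n x‖} ≤
      K * (Q * (V n + ENNReal.ofReal (α n))) ^ (N : ℝ)⁻¹ * (M + M) +
        ENNReal.ofReal (α n) / ENNReal.ofReal (A δ) := by
    intro n
    obtain ⟨hum, hGm, φ, hφ, hφu, hφG⟩ := hu n
    obtain ⟨k, hk1, hk2⟩ := ((hφu.eventually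
      (gt_mem_nhds (ENNReal.ofReal_pos.2 (hα0 n)))).and (hφG.eventually
      (gt_mem_nhds (ENNReal.ofReal_pos.2 (hα0 n))))).exists
    obtain ⟨hφs, hφc⟩ := hφ k
    set ψ := φ k
    have hψm : AEStronglyMeasurable ψ := hφs.continuous.aestronglyMeasurable
    have hαc : ENNReal.ofReal (α n) ≤ ENNReal.ofReal c :=
      ENNReal.ofReal_le_ofReal ((hα1 n).trans hc)
    have hM1 : ∫⁻ x, ENNReal.ofReal (A ‖ψ x‖) ≤ M :=
      hA.lintegral_le_rpow_mul (by linarith)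
        (hA.lintegral_le_two hψm hum hc0 (hk1.trans_le hαc) (huc n))
    have hM2 : ∫⁻ x, ENNReal.ofReal (A ‖fderiv ℝ ψ x‖) ≤ M := by
      have := hA.lintegral_le_rpow_mul (by linarith)
        (hA.lintegral_le_two (continuous_gradient hφs).aestronglyMeasurable hGm hc0
          (hk2.trans_le hαc) (hGc n))
      simpa only [norm_gradient] using this
    have hdiff : ∫⁻ x, ENNReal.ofReal (A ‖ψ x - u n x‖) ≤ ENNReal.ofReal (α n) :=
      hA.lintegral_le_of_luxemburgNorm_lt hl (hα0 n) (hα1 n) hk1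
    have hloc : ∀ y, volume ({x | δ ≤ ‖ψ x‖} ∩ Metric.ball y R) ≤
        Q * (V n + ENNReal.ofReal (α n)) := by
      intro y
      have h1 := hA.measure_norm_ge_le hψm one_pos hδ
        (Measure.absolutelyContinuous_of_le
          (Measure.restrict_le_self (μ := volume) (s := Metric.ball y R)))
      rw [Measure.restrict_apply (isClosed_le continuous_const
        hφs.continuous.norm).measurableSet] at h1
      simp only [div_one] at h1
      refine h1.trans ?_
      rw [hQ, ENNReal.mul_div_right_comm.symm]
      gcongr
      have h2 : ∀ x, ENNReal.ofReal (A ‖ψ x‖) ≤ ENNReal.ofReal (2 ^ m) *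
          (ENNReal.ofReal (A ‖u n x‖) + ENNReal.ofReal (A ‖ψ x - u n x‖)) := fun x => by
        rw [← ENNReal.ofReal_add (hA.nonneg' _) (hA.nonneg' _),
          ← ENNReal.ofReal_mul (by positivity)]
        refine ENNReal.ofReal_le_ofReal (le_trans (hA.mono (norm_nonneg _) ?_)
          (hA.apply_add_le (norm_nonneg _) (norm_nonneg _)))
        simpa using norm_add_le (u n x) (ψ x - u n x)
      refine (lintegral_mono h2).trans ?_
      rw [lintegral_const_mul' _ _ ENNReal.ofReal_ne_top]
      gcongr
      have hmu : AEMeasurable (fun x => ENNReal.ofReal (A ‖u n x‖))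
          (volume.restrict (Metric.ball y R)) := by
        simpa using hA.aemeasurable_comp hum 1
          (Measure.absolutelyContinuous_of_le
            (Measure.restrict_le_self (μ := volume) (s := Metric.ball y R)))
      rw [lintegral_add_left' hmu]
      gcongr
      · exact le_iSup (fun y => modularOn A (Metric.ball y R) (u n)) y
      · exact (setLIntegral_le_lintegral _ _).trans hdiff
    -- The threshold 3δ leaves 2δ for the test function and δ for the error.
    have hsub : {x | 3 * δ ≤ ‖u n x‖} ⊆ {x | 2 * δ ≤ ‖ψ x‖} ∪ {x | δ ≤ ‖ψ x - u n x‖} := by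
      intro x hx
      by_contra! h
      simp only [mem_union, mem_ofPred_eq, not_or, not_le] at h hx
      have := norm_sub_norm_le (u n x) (ψ x)
      rw [norm_sub_rev] at this
      linarith [h.1, h.2]
    refine (measure_mono hsub).trans ((measure_union_le _ _).trans (add_le_add ?_ ?_))
    · refine (H ψ (hφs.of_le (by simp)) hφc _ hloc).trans ?_
      gcongr
    · have := hA.measure_norm_ge_le (hψm.sub hum) one_pos hδ Measure.AbsolutelyContinuous.rfl
      simp only [div_one] at this
      refine this.trans ?_
      gcongr
      exact hdiff
  refine tendsto_of_tendsto_of_tendsto_of_le_of_le tendsto_const_nhds ?_ (fun _ => zero_le) hbound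
  have hN0 : 0 < (N : ℝ)⁻¹ := by positivity
  have h1 : Tendsto (fun n => (Q * (V n + ENNReal.ofReal (α n))) ^ (N : ℝ)⁻¹) atTop (𝓝 0) := by
    have := ENNReal.Tendsto.const_mul (hv.add hαlim) (Or.inr hQtop)
    rw [add_zero, mul_zero] at this
    have h2 := (ENNReal.continuous_rpow_const (y := (N : ℝ)⁻¹)).tendsto 0
    rw [ENNReal.zero_rpow_of_pos hN0] at h2
    exact h2.comp this
  have hMtop : M ≠ ⊤ := ENNReal.mul_ne_top ENNReal.ofReal_ne_top (by simp)
  have h2 := ENNReal.Tendsto.mul_const (ENNReal.Tendsto.const_mul h1 (Or.inr hK))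
    (Or.inr (ENNReal.add_ne_top.2 ⟨hMtop, hMtop⟩))
  have h3 := ENNReal.Tendsto.div_const hαlim (Or.inr hAδ)
  have := h2.add h3
  simpa using this

end

end IsGrowth

/-! ### Splitting B between A and A_* -/

namespace IsNFunction

variable {B : ℝ → ℝ} (hB : IsNFunction B)
include hB

theorem monotoneOn : MonotoneOn B (Ici 0) := by
  intro s hs t ht hst
  have hs0 : 0 ≤ s := hs
  rcases eq_or_lt_of_le (show 0 ≤ t from ht) with rfl | ht0
  · rw [le_antisymm hst hs0]
  have h1 : s / t ≤ 1 := (div_le_one ht0).2 hst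
  have := hB.convex.2 (mem_univ 0) (mem_univ t) (sub_nonneg.2 h1)
    (div_nonneg hs0 ht0.le) (by ring)
  simp only [smul_eq_mul, mul_zero, zero_add, (hB.eq_zero_iff 0).2 rfl,
    div_mul_cancel₀ _ ht0.ne'] at this
  exact this.trans (mul_le_of_le_one_left (hB.nonneg t) h1)

theorem apply_norm (t : ℝ) : B ‖t‖ = B t := by
  rcases abs_choice t with h | h <;> simp [Real.norm_eq_abs, h, hB.even]

theorem exists_apply_mul_le (hd : SatisfiesDelta2 B) (c : ℝ) :
    ∃ K : ℝ, 0 < K ∧ ∀ t : ℝ, 0 ≤ t → B (c * t) ≤ K * B t := by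
  obtain ⟨K, hK, h⟩ := hd
  obtain ⟨j, hj⟩ := pow_unbounded_of_one_lt |c| one_lt_two
  have hpow : ∀ (j : ℕ) (t : ℝ), 0 ≤ t → B (2 ^ j * t) ≤ K ^ j * B t := by
    intro j
    induction j with
    | zero => intro t _; simp
    | succ j ih =>
      intro t ht
      calc B (2 ^ (j + 1) * t) = B (2 * (2 ^ j * t)) := by ring_nf
        _ ≤ K * B (2 ^ j * t) := h _ (by positivity)
        _ ≤ K * (K ^ j * B t) := by gcongr; exact ih t ht
        _ = _ := by ring
  refine ⟨K ^ j, by positivity, fun t ht => le_trans ?_ (hpow j t ht)⟩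
  rw [← hB.apply_norm (c * t)]
  refine hB.monotoneOn (norm_nonneg _) (show 0 ≤ 2 ^ j * t by positivity) ?_
  rw [norm_mul, Real.norm_of_nonneg ht]
  exact mul_le_mul_of_nonneg_right hj.le ht

theorem exists_le_add {A S : ℝ → ℝ} (hd : SatisfiesDelta2 B) (hA0 : ∀ t, 0 ≤ A t)
    (hA : ∀ t, t ≠ 0 → 0 < A t)    (hS0 : ∀ t, 0 ≤ S t) (hS : ∀ t, t ≠ 0 → 0 < S t)
    (h1 : Tendsto (fun t => B t / A t) (𝓝[≠] 0) (𝓝 0))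
    (h2 : Tendsto (fun t => B t / S t) (comap (fun t : ℝ => |t|) atTop) (𝓝 0))
    {σ : ℝ} (hσ : 0 < σ) {ε : ℝ} (hε : 0 < ε) :
    ∃ δ C : ℝ, 0 < δ ∧ 0 ≤ C ∧ ∀ t, B t ≤ ε * A ‖t‖ + ε * S (σ * ‖t‖) +
      {t : ℝ | 3 * δ ≤ ‖t‖}.indicator (fun _ => C) t := by
  have hB0 : B 0 = 0 := (hB.eq_zero_iff 0).2 rfl
  -- K absorbs the rescaling B(t) ≤ K B(σt), hence the ratio ε/K demanded at infinity.
  obtain ⟨K, hK, hKB⟩ := hB.exists_apply_mul_le hd σ⁻¹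
  obtain ⟨r, hr, hrB⟩ : ∃ r : ℝ, 0 < r ∧ ∀ t, t ≠ 0 → |t| < r → B t ≤ ε * A t := by
    have := h1.eventually (gt_mem_nhds hε)
    rw [eventually_nhdsWithin_iff, Metric.eventually_nhds_iff] at this
    obtain ⟨r, hr, h⟩ := this
    refine ⟨r, hr, fun t ht htr => ?_⟩
    exact ((div_lt_iff₀ (hA t ht)).1 (h (by simpa using htr) ht)).le
  obtain ⟨T, hT, hTB⟩ : ∃ T : ℝ, 0 < T ∧ ∀ t, T ≤ t → B t ≤ ε / K * S t := by
    have := h2.eventually (gt_mem_nhds (div_pos hε hK))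
    rw [eventually_comap] at this
    obtain ⟨T, hT⟩ := eventually_atTop.1 this
    refine ⟨max T 1, by positivity, fun t ht => ?_⟩
    have ht0 : 0 < t := one_pos.trans_le ((le_max_right _ _).trans ht)
    have := hT t ((le_max_left _ _).trans ht) t (abs_of_pos ht0)
    exact ((div_lt_iff₀ (hS t ht0.ne')).1 this).le
  -- Between r and T/σ monotonicity bounds B by its value at T/σ.
  refine ⟨r / 3, B (T / σ), by positivity, hB.nonneg _, fun t => ?_⟩
  have hs : 0 ≤ ‖t‖ := norm_nonneg t
  have ha : 0 ≤ ε * A ‖t‖ := mul_nonneg hε.le (hA0 _)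
  have hb : 0 ≤ ε * S (σ * ‖t‖) := mul_nonneg hε.le (hS0 _)
  have hi : 0 ≤ {t : ℝ | 3 * (r / 3) ≤ ‖t‖}.indicator (fun _ => B (T / σ)) t :=
    indicator_nonneg (fun _ _ => hB.nonneg _) _
  rw [← hB.apply_norm t]
  by_cases ht : ‖t‖ = 0
  · have : B ‖t‖ = 0 := by rw [ht, hB0]
    linarith
  rcases lt_or_ge ‖t‖ r with h | h
  · have := hrB ‖t‖ ht (by rwa [abs_of_nonneg hs])
    linarith
  rcases le_or_gt T (σ * ‖t‖) with h' | h'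
  · have h3 := hKB (σ * ‖t‖) (by positivity)
    rw [inv_mul_cancel_left₀ hσ.ne'] at h3
    have h4 : K * B (σ * ‖t‖) ≤ K * (ε / K * S (σ * ‖t‖)) := by gcongr; exact hTB _ h'
    have h5 : K * (ε / K * S (σ * ‖t‖)) = ε * S (σ * ‖t‖) := by field_simp
    linarith
  · have h3 : B ‖t‖ ≤ B (T / σ) := by
      refine hB.monotoneOn hs (show 0 ≤ T / σ by positivity) ?_
      rw [le_div_iff₀ hσ]
      linarith
    rw [indicator_of_mem (show t ∈ {t : ℝ | 3 * (r / 3) ≤ ‖t‖} by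
      rw [mem_ofPred_eq]; linarith)]
    linarith

theorem lintegral_le {N : ℕ} {A S : ℝ → ℝ} {ε σ δ C : ℝ} (hε : 0 ≤ ε) (hC : 0 ≤ C)
    (hA0 : ∀ t, 0 ≤ A t) (hS0 : ∀ t, 0 ≤ S t) (hAc : Continuous A) (hSc : Continuous S)
    (h : ∀ t, B t ≤ ε * A ‖t‖ + ε * S (σ * ‖t‖) +
      {t : ℝ | 3 * δ ≤ ‖t‖}.indicator (fun _ => C) t)
    {u : EuclideanSpace ℝ (Fin N) → ℝ} (hu : AEStronglyMeasurable u) {a b : ℝ≥0∞}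
    (ha : ∫⁻ x, ENNReal.ofReal (A ‖u x‖) ≤ a)
    (hb : ∫⁻ x, ENNReal.ofReal (S (σ * ‖u x‖)) ≤ b) :
    ∫⁻ x, ENNReal.ofReal (B ‖u x‖) ≤
      ENNReal.ofReal ε * (a + b) + ENNReal.ofReal C * volume {x | 3 * δ ≤ ‖u x‖} := by
  have hmeas : MeasurableSet {t : ℝ | 3 * δ ≤ ‖t‖} :=
    (isClosed_le continuous_const continuous_norm).measurableSet
  have hum := hu.aemeasurable
  have hmA : AEMeasurable fun x => ENNReal.ofReal (A ‖u x‖) :=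
    (hAc.measurable.comp_aemeasurable hum.norm).ennreal_ofReal
  have hmS : AEMeasurable fun x => ENNReal.ofReal (S (σ * ‖u x‖)) :=
    (hSc.measurable.comp_aemeasurable (hum.norm.const_mul σ)).ennreal_ofReal
  have hmAS : AEMeasurable fun x => ENNReal.ofReal ε *
      (ENNReal.ofReal (A ‖u x‖) + ENNReal.ofReal (S (σ * ‖u x‖))) := (hmA.add hmS).const_mul _
  have hnull : NullMeasurableSet {x | 3 * δ ≤ ‖u x‖} := hum.nullMeasurable hmeas
  have hpt : ∀ x, ENNReal.ofReal (B ‖u x‖) ≤ ENNReal.ofReal ε *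
      (ENNReal.ofReal (A ‖u x‖) + ENNReal.ofReal (S (σ * ‖u x‖))) +
      {x | 3 * δ ≤ ‖u x‖}.indicator (fun _ => ENNReal.ofReal C) x := by
    intro x
    have hi : {x | 3 * δ ≤ ‖u x‖}.indicator (fun _ => ENNReal.ofReal C) x =
        ENNReal.ofReal ({t : ℝ | 3 * δ ≤ ‖t‖}.indicator (fun _ => C) (u x)) := by
      simp only [indicator, mem_ofPred_eq]
      split_ifs <;> simp
    rw [hi, ← ENNReal.ofReal_add (hA0 _) (hS0 _), ← ENNReal.ofReal_mul hε, hB.apply_norm,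
      ← ENNReal.ofReal_add (mul_nonneg hε (add_nonneg (hA0 _) (hS0 _)))
        (indicator_nonneg (fun _ _ => hC) _), mul_add]
    exact ENNReal.ofReal_le_ofReal (h _)
  refine (lintegral_mono hpt).trans ?_
  rw [lintegral_add_left' hmAS, lintegral_const_mul' _ _ ENNReal.ofReal_ne_top,
    lintegral_add_left' hmA, lintegral_indicator_const₀ hnull]
  gcongr

theorem tendsto_luxemburgNorm {N : ℕ} (hd : SatisfiesDelta2 B)
    {u : ℕ → EuclideanSpace ℝ (Fin N) → ℝ}
    (h : Tendsto (fun n => ∫⁻ x, ENNReal.ofReal (B ‖u n x‖)) atTop (𝓝 0)) :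
    Tendsto (fun n => luxemburgNorm B (u n)) atTop (𝓝 0) := by
  refine ENNReal.tendsto_nhds_zero.2 fun e he => ?_
  obtain ⟨α, hα0, hα⟩ := ENNReal.lt_iff_exists_nnreal_btwn.1 he
  have hα0 : (0 : ℝ) < α := by exact_mod_cast hα0
  obtain ⟨K, hK, hKB⟩ := hB.exists_apply_mul_le hd (α : ℝ)⁻¹
  have h1 := ENNReal.Tendsto.const_mul h (Or.inr (ENNReal.ofReal_ne_top (r := K)))
  rw [mul_zero] at h1
  filter_upwards [h1.eventually (ge_mem_nhds one_pos)] with n hn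
  refine le_trans (luxemburgNorm_le hα0 (le_trans ?_ hn)) (by simpa using hα.le)
  rw [← lintegral_const_mul' _ _ ENNReal.ofReal_ne_top]
  refine lintegral_mono fun x => ?_
  rw [← ENNReal.ofReal_mul hK.le, div_eq_inv_mul]
  exact ENNReal.ofReal_le_ofReal (hKB _ (norm_nonneg _))

end IsNFunction

end OrliczLions

/-! ### Conclusion -/

theorem mainTheorem3
    (N : ℕ) (a : ℝ → ℝ)
    (ha_nonneg : ∀ t : ℝ, 0 < t → 0 ≤ a t)
    (ha_C1 : ContDiffOn ℝ 1 a (Set.Ioi 0))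
    (ha1 : ∀ t : ℝ, 0 < t → 0 < deriv (fun s => a s * s) t)
    (l m : ℝ) (hl : l ∈ Set.Ioo (1 : ℝ) N) (hm : m ∈ Set.Ioo (1 : ℝ) N)
    (hlm : l ≤ m) (hml : m < l * N / (N - l))
    (ha2 : ∀ t : ℝ, t ≠ 0 →
      l ≤ a |t| * t ^ 2 / OrliczLions.primitiveA a t ∧
      a |t| * t ^ 2 / OrliczLions.primitiveA a t ≤ m)
    (u : ℕ → EuclideanSpace ℝ (Fin N) → ℝ)
    (G : ℕ → EuclideanSpace ℝ (Fin N) → EuclideanSpace ℝ (Fin N))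
    (hu : ∀ n, OrliczLions.MemOrliczSobolev (OrliczLions.primitiveA a) (u n) (G n))
    (hbdd : ∃ C : NNReal, ∀ n,
      OrliczLions.luxemburgNorm (OrliczLions.primitiveA a) (G n) +
        OrliczLions.luxemburgNorm (OrliczLions.primitiveA a) (u n) ≤ (C : ENNReal))
    (hvanish : ∃ R : ℝ, 0 < R ∧
      Filter.Tendsto
        (fun n => ⨆ y : EuclideanSpace ℝ (Fin N),
          OrliczLions.modularOn (OrliczLions.primitiveA a) (Metric.ball y R) (u n))
        Filter.atTop (nhds 0))
    (B : ℝ → ℝ) (hB : OrliczLions.IsNFunction B) (hB_delta : OrliczLions.SatisfiesDelta2 B)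
    (hB1 : Filter.Tendsto (fun t => B t / OrliczLions.primitiveA a t)
      (nhdsWithin 0 {0}ᶜ) (nhds 0))
    (hB2 : Filter.Tendsto
      (fun t => B t / OrliczLions.sobolevConjugate N (OrliczLions.primitiveA a) t)
      (Filter.comap (fun t : ℝ => |t|) Filter.atTop) (nhds 0)) :
    (∀ n, OrliczLions.MemOrlicz B (u n)) ∧
      Filter.Tendsto (fun n => OrliczLions.luxemburgNorm B (u n)) Filter.atTop (nhds 0) := by
  have hA := OrliczLions.isGrowth_primitiveA ha_nonneg ha_C1 ha1 hl.1 ha2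
  set A := OrliczLions.primitiveA a
  have hS0 := hA.sobolevConjugate_nonneg (N := N) hl.1.le hm.1 hm.2
  have hSc := hA.continuous_sobolevConjugate (N := N) hl.1.le hm.1 hm.2
  have hSpos : ∀ t, t ≠ 0 → 0 < OrliczLions.sobolevConjugate N A t := fun t ht =>
    (hA.isGauge_sobolevConjugateInv hl.1.le hm.1 hm.2).inv.pos (abs_pos.2 ht)
  have hSabs : ∀ σ t : ℝ, OrliczLions.sobolevConjugate N A (σ * ‖t‖) =
      OrliczLions.sobolevConjugate N A (σ * t) := fun σ t => by
    simp [OrliczLions.sobolevConjugate, abs_mul]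
  have hApos : ∀ t, t ≠ 0 → 0 < A t := fun t ht => hA.abs t ▸ hA.pos (abs_pos.2 ht)
  obtain ⟨C, hC⟩ := hbdd
  set c : ℝ := C + 1 with hc
  have hc1 : 1 ≤ c := by rw [hc]; linarith [C.coe_nonneg]
  have hc0 : 0 < c := by linarith
  have hCc : (C : ENNReal) < ENNReal.ofReal c := by
    rw [← ENNReal.ofReal_coe_nnreal]
    exact (ENNReal.ofReal_lt_ofReal_iff hc0).2 (by rw [hc]; linarith)
  have huc : ∀ n, OrliczLions.luxemburgNorm A (u n) < ENNReal.ofReal c := fun n =>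
    (le_add_self.trans (hC n)).trans_lt hCc
  have hGc : ∀ n, OrliczLions.luxemburgNorm A (G n) < ENNReal.ofReal c := fun n =>
    (le_self_add.trans (hC n)).trans_lt hCc
  obtain ⟨η, hη, hX⟩ := hA.exists_memOrliczSobolev_const (N := N) hl.1 hm.1 hm.2
  have hσ : 0 < η / c := by positivity
  have hb : ∀ n, ∫⁻ x, ENNReal.ofReal
      (OrliczLions.sobolevConjugate N A (η / c * ‖u n x‖)) ≤ 1 := fun n => by
    simpa only [hSabs] using hX (u n) (G n) (hu n) c hc0 (hGc n)
  set M : ENNReal := ENNReal.ofReal (c ^ m) * 1 with hM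
  have hMtop : M ≠ ⊤ := ENNReal.mul_ne_top ENNReal.ofReal_ne_top ENNReal.one_ne_top
  have ha : ∀ n, ∫⁻ x, ENNReal.ofReal (A ‖u n x‖) ≤ M := fun n =>
    hA.lintegral_le_rpow_mul hc1
      (OrliczLions.lintegral_le_one_of_luxemburgNorm_lt hA.monotoneOn (huc n))
  have hbound : ∀ ε : ℝ, 0 < ε → ∃ δ C : ℝ, 0 < δ ∧ ∀ n,
      ∫⁻ x, ENNReal.ofReal (B ‖u n x‖) ≤ ENNReal.ofReal ε * (M + 1) +
        ENNReal.ofReal C * volume {x | 3 * δ ≤ ‖u n x‖} := by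
    intro ε hε
    obtain ⟨δ, C, hδ, hC, h⟩ := hB.exists_le_add hB_delta hA.nonneg' hApos hS0 hSpos hB1 hB2 hσ hε
    exact ⟨δ, C, hδ, fun n =>
      hB.lintegral_le hε.le hC hA.nonneg' hS0 hA.continuous hSc h (hu n).1 (ha n) (hb n)⟩
  have hM1top : M + 1 ≠ ⊤ := ENNReal.add_ne_top.2 ⟨hMtop, ENNReal.one_ne_top⟩
  refine ⟨fun n => ⟨(hu n).1, ?_⟩, hB.tendsto_luxemburgNorm hB_delta ?_⟩
  · obtain ⟨δ, C, hδ, h⟩ := hbound 1 one_pos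
    rw [OrliczLions.modularOn, Measure.restrict_univ]
    refine (h n).trans_lt (ENNReal.add_lt_top.2
      ⟨ENNReal.mul_lt_top ENNReal.ofReal_lt_top hM1top.lt_top,
        ENNReal.mul_lt_top ENNReal.ofReal_lt_top ?_⟩)
    -- For a single n, Chebyshev already makes the superlevel set of finite measure.
    have h3 : 0 < 3 * δ := by positivity
    refine (hA.measure_norm_ge_le (hu n).1 one_pos h3
      Measure.AbsolutelyContinuous.rfl).trans_lt (ENNReal.div_lt_top ?_ ?_)
    · simpa only [div_one] using ((ha n).trans_lt hMtop.lt_top).ne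
    · simpa using hA.pos h3
  · obtain ⟨R, hR, hv⟩ := hvanish
    refine ENNReal.tendsto_nhds_zero.2 fun e he => ?_
    have he2 : 0 < e / 2 := ENNReal.half_pos he.ne'
    -- ε is fixed first, using the uniform modular bounds; δ and C depend on it, and only then does
    -- n tend to infinity.
    obtain ⟨ε, hε, hεe⟩ : ∃ ε : ℝ, 0 < ε ∧ ENNReal.ofReal ε * (M + 1) ≤ e / 2 := by
      have h1 : Tendsto (fun ε : ℝ => ENNReal.ofReal ε * (M + 1)) (𝓝[>] 0) (𝓝 0) := by
        have h2 := ENNReal.Tendsto.mul_const (b := M + 1)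
          (ENNReal.continuous_ofReal.tendsto 0) (Or.inr hM1top)
        rw [ENNReal.ofReal_zero, zero_mul] at h2
        exact h2.mono_left nhdsWithin_le_nhds
      obtain ⟨ε, h3, h4⟩ := ((ENNReal.tendsto_nhds_zero.1 h1 _ he2).and
        self_mem_nhdsWithin).exists
      exact ⟨ε, h4, h3⟩
    obtain ⟨δ, C, hδ, h⟩ := hbound ε hε
    have h5 := ENNReal.Tendsto.const_mul (a := ENNReal.ofReal C)
      (hA.tendsto_measure_superlevel hl.1.le (hl.1.trans hl.2) hu hc1 huc hGc hR hv hδ)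
      (Or.inr ENNReal.ofReal_ne_top)
    rw [mul_zero] at h5
    filter_upwards [ENNReal.tendsto_nhds_zero.1 h5 _ he2] with n hn
    exact (h n).trans ((add_le_add hεe hn).trans_eq (ENNReal.add_halves e))
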